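/- Let $w:(0,\infty)\to(0,\infty)$ be a measurable weight with $1/w$ locally integrable on $(0,\infty)$ (for instance, $w$ continuous), and let $L^2=L^2((0,\infty),w(r)\,dr)$ be the space of complex-valued square integrable functions, with norm $\|\cdot\|_2$ and inner product $\langle f,g\rangle=\int_0^\infty f\,\overline g\,w\,dr$. Let $P=\sum_{i=0}^n a_i(r)\,\frac{d^i}{dr^i}$, $n\ge 1$, be an elliptic differential operator on $(0,\infty)$, i.e. the coefficients $a_i$ are continuous and $a_n(r)\neq 0$ for all $r>0$. Let $(\psi_k)_{k\ge 0}$ be an orthogonal basis of $L^2$ consisting of functions of class $C^n$ on $(0,\infty)$ with $P\psi_k=\lambda_k\psi_k$ on $(0,\infty)$, and put $c_k^{-1}=\int_0^\infty|\psi_k|^2\,w\,dr$. Assume that (i) $\psi_k(0)=1$, in the sense that $\lim_{r\to 0^+}\psi_k(r)=1$, for every $k$; (ii) $\lambda_k\ge 0$ for every $k$; (iii) $\lambda_k$ and $c_k$ grow polynomially, in the sense that there are $A,\alpha>0$ and $C,\beta\in\mathbb R$ with $\lambda_k\ge A k^{\alpha}$ and $c_k\le C k^{\beta}$ for all sufficiently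 large $k$. For $f,g\in L^2$ write $Pf=g$ if $\langle g,\psi_k\rangle=\langle f,P\psi_k\rangle$ for all $k$; this is the self-adjoint operator on $L^2$ obtained as the closure of the differential operator $P$ on the linear span of the $\psi_k$, and $\|P^mf\|_2^2=\sum_k\lambda_k^{2m}c_k|\langle f,\psi_k\rangle|^2$. Let $f\in L^2$ be such that $P^mf\in L^2$ for all $m\in\mathbb N$ (that is, $f$ lies in the domain of every power $P^m$) and $$\sum_{m=1}^\infty\|P^mf\|_2^{-1/(2m)}=\infty,$$ where a term with $P^mf=0$ counts as $\infty$. If $f$ vanishes (almost everywhere) on some interval $(0,\delta)$, $\delta>0$, then $f=0$ (almost everywhere) on $(0,\infty)$. -/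

import Mathlib

open Set Filter Topology MeasureTheory
open scoped ComplexConjugate

noncomputable section

namespace EigenExpansion

/-- The measure `w(r) dr` on `ℝ⁺ = (0, ∞)`, regarded as a measure on `ℝ`. -/
def weightMeasure (w : ℝ → ℝ) : Measure ℝ :=
  (volume.restrict (Ioi (0 : ℝ))).withDensity fun r => ENNReal.ofReal (w r)

/-- The ordinary differential operator `u ↦ ∑_{i ≤ n} a_i u^{(i)}`. -/
def diffOp (n : ℕ) (a : ℕ → ℝ → ℂ) (u : ℝ → ℂ) (r : ℝ) : ℂ :=
  ∑ i ∈ Finset.range (n + 1), a i r * iteratedDeriv i u r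

/-- `∑_{i ≤ n} a_i (d/dr)^i` is an elliptic differential operator of order `n ≥ 1` on `(0, ∞)`:
its coefficients are continuous there and the leading one has no zero. -/
structure IsElliptic (n : ℕ) (a : ℕ → ℝ → ℂ) : Prop where
  order_pos : 0 < n
  continuousOn_coeff : ∀ i ≤ n, ContinuousOn (a i) (Ioi 0)
  leading_ne_zero : ∀ r > 0, a n r ≠ 0

/-- The sequence `ψ` is an orthogonal basis of the complex Hilbert space `L²(μ)`. -/
structure IsOrthogonalBasis (μ : Measure ℝ) (ψ : ℕ → ℝ → ℂ) : Prop where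
  memLp : ∀ k, MemLp (ψ k) 2 μ
  ne_zero : ∀ k, ¬ ψ k =ᵐ[μ] 0
  orthogonal : ∀ j k, j ≠ k → ∫ r, conj (ψ j r) * ψ k r ∂μ = 0
  dense_span :
    (Submodule.span ℂ (range fun k => (memLp k).toLp (ψ k))).topologicalClosure = ⊤

/-- `c_k`, given by `c_k⁻¹ = ∫ |ψ_k|² dμ`. -/
def normConst (μ : Measure ℝ) (ψ : ℕ → ℝ → ℂ) (k : ℕ) : ℝ :=
  (∫ r, ‖ψ k r‖ ^ 2 ∂μ)⁻¹

/-- `g = P f` in `L²(μ)`, where `P` is the `L²`-realization, determined by the basis `ψ`, of the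
differential operator with coefficients `a`: `f` and `g` are in `L²(μ)` and
`⟨g, ψ_k⟩ = ⟨f, P ψ_k⟩` for every `k`. (This is the Hilbert space adjoint of the differential
operator with domain `span {ψ_k}`; if the `ψ_k` are an orthogonal basis of eigenfunctions with real
eigenvalues it is self-adjoint and is also the closure of that operator.) -/
def IsImage (μ : Measure ℝ) (n : ℕ) (a : ℕ → ℝ → ℂ) (ψ : ℕ → ℝ → ℂ) (f g : ℝ → ℂ) : Prop :=
  MemLp f 2 μ ∧ MemLp g 2 μ ∧
    ∀ k, ∫ r, conj (ψ k r) * g r ∂μ = ∫ r, conj (diffOp n a (ψ k) r) * f r ∂μ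

end EigenExpansion

end

/-!
The closure of an elliptic operator is local: interior estimates bound the derivatives of `u` by the
`L¹` norms of `u` and `P u`, so if `W_i → 0` and `P W_i → g` in `L¹` near a point, then `g = 0`
there. Hence all `P ^ m f` vanish on the open set `Ω` on which `f` does. For `φ ∈ L²` supported in
`Ω`, the products `b_k` of the coordinates of `φ` and `f` in the normalized basis thus have
vanishing moments `∑_k λ_k ^ m b_k = ⟨φ, P ^ m f⟩ = 0`. These are, up to sign, the derivatives of
even order at `0` of `t ↦ ∑_k cos (√λ_k t) b_k`, which lies in a quasi-analytic class by Carleman's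
condition and therefore vanishes identically. Its mean value against `cos (√ev t)` shows that the
sum of the `b_k` with `λ_k = ev` is zero: `φ` is orthogonal to the component of `f` in the
`ev`-eigenspace. Taking `φ` to be this component cut off to `Ω`, the component vanishes on `Ω`.
Being a solution of the equation `P u = ev u`, it vanishes identically.
-/

namespace EigenExpansion

/-! ### Carleman's inequality -/

theorem add_one_pow_le_exp_mul_factorial (n : ℕ) :
    ((n : ℝ) + 1) ^ n ≤ Real.exp n * n.factorial := by
  induction n with
  | zero => simp
  | succ n ih =>
    have one_add_inv_pow_le : (((n : ℝ) + 2) / (n + 1)) ^ (n + 1) ≤ Real.exp 1 := by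
      calc (((n : ℝ) + 2) / (n + 1)) ^ (n + 1)
          = (1 / ((n : ℝ) + 1) + 1) ^ (n + 1) := by congr 1; field_simp; ring
        _ ≤ Real.exp (1 / ((n : ℝ) + 1)) ^ (n + 1) := by gcongr; exact Real.add_one_le_exp _
        _ = Real.exp 1 := by rw [← Real.exp_nat_mul]; congr 1; push_cast; field_simp
    calc (((n + 1 : ℕ) : ℝ) + 1) ^ (n + 1)
        = (((n : ℝ) + 2) / (n + 1)) ^ (n + 1) * ((n + 1) ^ n * (n + 1)) := by
          rw [← pow_succ, ← mul_pow]; congr 1; push_cast; field_simp; ring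
      _ ≤ Real.exp 1 * (Real.exp n * n.factorial * (n + 1)) := by gcongr
      _ = Real.exp (n + 1 : ℕ) * (n + 1).factorial := by
          rw [Nat.factorial_succ]; push_cast; rw [Real.exp_add]; ring

theorem geom_mean_le_exp_one_mul_weighted_sum {a : ℕ → ℝ} (ha : ∀ i, 0 ≤ a i) (n : ℕ) :
    (∏ i ∈ Finset.range (n + 1), a i) ^ ((1 : ℝ) / (n + 1)) ≤
      Real.exp 1 * ((∑ i ∈ Finset.range (n + 1), ((i : ℝ) + 1) * a i) /
        (((n : ℝ) + 1) * (n + 2))) := by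
  set S := ∑ i ∈ Finset.range (n + 1), ((i : ℝ) + 1) * a i
  set G := (∏ i ∈ Finset.range (n + 1), a i) ^ ((1 : ℝ) / (n + 1))
  have hprod_nonneg : 0 ≤ ∏ i ∈ Finset.range (n + 1), a i := Finset.prod_nonneg fun i _ => ha i
  have hfactorial : ∏ i ∈ Finset.range (n + 1), ((i : ℝ) + 1) = ((n + 1).factorial : ℝ) := by
    rw [← Finset.prod_range_add_one_eq_factorial]; push_cast; rfl
  have am_gm : ((n + 1).factorial : ℝ) ^ ((1 : ℝ) / (n + 1)) * G ≤ S / (n + 1) := by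
    have h := Real.geom_mean_le_arith_mean (Finset.range (n + 1)) (fun _ => (1 : ℝ))
      (fun i => ((i : ℝ) + 1) * a i) (fun _ _ => zero_le_one)
      (by simpa using Nat.cast_add_one_pos n) (fun i _ => mul_nonneg (by positivity) (ha i))
    simp only [Real.rpow_one, one_mul, Finset.sum_const, Finset.card_range, nsmul_eq_mul, mul_one,
      Finset.prod_mul_distrib, hfactorial, Nat.cast_add, Nat.cast_one, ← one_div] at h
    rwa [Real.mul_rpow (by positivity) hprod_nonneg] at h
  have stirling : ((n : ℝ) + 2) / Real.exp 1 ≤ ((n + 1).factorial : ℝ) ^ ((1 : ℝ) / (n + 1)) := by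
    have h : ((n : ℝ) + 2) ^ (n + 1) ≤ Real.exp (n + 1 : ℕ) * (n + 1).factorial := by
      convert add_one_pow_le_exp_mul_factorial (n + 1) using 2
      push_cast; ring
    rw [one_div, Real.le_rpow_inv_iff_of_pos (by positivity) (by positivity) (by positivity),
      show ((n : ℝ) + 1) = ((n + 1 : ℕ) : ℝ) by push_cast; rfl, Real.rpow_natCast, div_pow,
      ← Real.exp_nat_mul, mul_one, div_le_iff₀' (Real.exp_pos _)]
    exact h
  have hG : 0 ≤ G := Real.rpow_nonneg hprod_nonneg _
  calc G = Real.exp 1 * (((n : ℝ) + 2) / Real.exp 1 * G) / (n + 2) := by field_simp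
    _ ≤ Real.exp 1 * (S / (n + 1)) / (n + 2) := by
      gcongr; exact (mul_le_mul_of_nonneg_right stirling hG).trans am_gm
    _ = Real.exp 1 * (S / ((n + 1) * (n + 2))) := by field_simp

theorem sum_range_weighted_sum_div (a : ℕ → ℝ) (N : ℕ) :
    ∑ n ∈ Finset.range N,
        (∑ i ∈ Finset.range (n + 1), ((i : ℝ) + 1) * a i) / (((n : ℝ) + 1) * (n + 2)) =
      ∑ i ∈ Finset.range N, a i - (∑ i ∈ Finset.range N, ((i : ℝ) + 1) * a i) / (N + 1) := by
  induction N with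
  | zero => simp
  | succ N ih =>
    rw [Finset.sum_range_succ, ih, Finset.sum_range_succ _ N, Finset.sum_range_succ _ N]
    push_cast
    have : (N : ℝ) + 1 + 1 ≠ 0 := by positivity
    field_simp
    ring

theorem carleman_inequality {a : ℕ → ℝ} (ha : ∀ i, 0 ≤ a i) (N : ℕ) :
    ∑ n ∈ Finset.range N, (∏ i ∈ Finset.range (n + 1), a i) ^ ((1 : ℝ) / (n + 1)) ≤
      Real.exp 1 * ∑ i ∈ Finset.range N, a i := by
  calc ∑ n ∈ Finset.range N, (∏ i ∈ Finset.range (n + 1), a i) ^ ((1 : ℝ) / (n + 1))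
      ≤ ∑ n ∈ Finset.range N, Real.exp 1 *
        ((∑ i ∈ Finset.range (n + 1), ((i : ℝ) + 1) * a i) / (((n : ℝ) + 1) * (n + 2))) :=
        Finset.sum_le_sum fun n _ => geom_mean_le_exp_one_mul_weighted_sum ha n
    _ = Real.exp 1 * (∑ i ∈ Finset.range N, a i -
        (∑ i ∈ Finset.range N, ((i : ℝ) + 1) * a i) / (N + 1)) := by
      rw [← Finset.mul_sum, sum_range_weighted_sum_div]
    _ ≤ Real.exp 1 * ∑ i ∈ Finset.range N, a i := by
      have hS : 0 ≤ ∑ i ∈ Finset.range N, ((i : ℝ) + 1) * a i :=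
        Finset.sum_nonneg fun i _ => mul_nonneg (by positivity) (ha i)
      gcongr
      exact sub_le_self _ (by positivity)

theorem summable_geom_mean {a : ℕ → ℝ} (ha : ∀ i, 0 ≤ a i) (hs : Summable a) :
    Summable fun n : ℕ => (∏ i ∈ Finset.range (n + 1), a i) ^ ((1 : ℝ) / (n + 1)) := by
  refine summable_of_sum_range_le (c := Real.exp 1 * ∑' i, a i)
    (fun n => Real.rpow_nonneg (Finset.prod_nonneg fun i _ => ha i) _) fun N => ?_
  exact (carleman_inequality ha N).trans <| by gcongr; exact hs.sum_le_tsum _ fun i _ => ha i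

theorem summable_rpow_of_summable_ratio {M : ℕ → ℝ} (hM : ∀ n, 0 < M n)
    (hs : Summable fun n => M n / M (n + 1)) :
    Summable fun n : ℕ => (M 0 / M (n + 1)) ^ ((1 : ℝ) / (n + 1)) := by
  have prod_ratio (n : ℕ) : ∏ i ∈ Finset.range n, (M i / M (i + 1)) = M 0 / M n := by
    induction n with
    | zero => simp [(hM 0).ne']
    | succ n ih => rw [Finset.prod_range_succ, ih, div_mul_div_cancel₀ (hM n).ne']
  simpa only [prod_ratio] using
    summable_geom_mean (fun i => div_nonneg (hM i).le (hM (i + 1)).le) hs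

/-! ### The Denjoy–Carleman theorem -/

section LogConvex

variable {M : ℕ → ℝ}

theorem monotone_ratio_of_sq_le_mul (hpos : ∀ n, 0 < M n)
    (hconv : ∀ n, M (n + 1) ^ 2 ≤ M n * M (n + 2)) : Monotone fun n => M (n + 1) / M n := by
  refine monotone_nat_of_le_succ fun n => ?_
  rw [div_le_div_iff₀ (hpos _) (hpos _)]
  linarith [hconv n]

theorem mul_pow_le_of_sq_le_mul (hpos : ∀ n, 0 < M n)
    (hconv : ∀ n, M (n + 1) ^ 2 ≤ M n * M (n + 2)) {N : ℕ} {c : ℝ} (hc : 0 ≤ c)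
    (hN : M (N + 1) * c ≤ M N) {n j : ℕ} (hj : n + j ≤ N + 1) : M (n + j) * c ^ j ≤ M n := by
  have mul_le {i : ℕ} (hi : i ≤ N) : M (i + 1) * c ≤ M i := by
    have hratio : M (i + 1) / M i ≤ M (N + 1) / M N := monotone_ratio_of_sq_le_mul hpos hconv hi
    have := hpos i
    have := hpos N
    calc M (i + 1) * c = M (i + 1) / M i * M i * c := by field_simp
      _ ≤ M (N + 1) / M N * M i * c := by gcongr
      _ = M (N + 1) * c / M N * M i := by ring
      _ ≤ 1 * M i := by gcongr; exact (div_le_one (hpos N)).2 hN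
      _ = M i := one_mul _
  induction j with
  | zero => simp
  | succ j ih =>
    calc M (n + (j + 1)) * c ^ (j + 1) = M (n + j + 1) * c * c ^ j := by
          rw [pow_succ, ← add_assoc]; ring
      _ ≤ M (n + j) * c ^ j := by gcongr; exact mul_le (by omega)
      _ ≤ M n := ih (by omega)

end LogConvex

section Bang

variable {E : Type*} [NormedAddCommGroup E] [NormedSpace ℝ E] {u : ℕ → ℝ → E} {M : ℕ → ℝ}

theorem hasDerivAt_pow_div_factorial (j : ℕ) (y : ℝ) :
    HasDerivAt (fun y : ℝ => y ^ (j + 1) / (j + 1).factorial) (y ^ j / j.factorial) y := by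
  refine ((hasDerivAt_pow (j + 1) y).div_const ((j + 1).factorial : ℝ)).congr_deriv ?_
  have : (j.factorial : ℝ) ≠ 0 := by positivity
  rw [Nat.factorial_succ]
  push_cast
  field_simp

theorem norm_add_le_taylor_sum (hu : ∀ n t, HasDerivAt (u n) (u (n + 1) t) t)
    (hM : ∀ n t, ‖u n t‖ ≤ M n) (x : ℝ) {h : ℝ} (hh : 0 ≤ h) (J n : ℕ) :
    ‖u n (x + h)‖ ≤ ∑ j ∈ Finset.range J, ‖u (n + j) x‖ * (h ^ j / j.factorial) +
      M (n + J) * (h ^ J / J.factorial) := by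
  induction J generalizing n h with
  | zero => simpa using hM n (x + h)
  | succ J ih =>
    refine image_norm_le_of_norm_deriv_right_le_deriv_boundary (a := 0) (b := h)
      (f := fun y => u n (x + y)) (f' := fun y => u (n + 1) (x + y))
      (B := fun y => ∑ j ∈ Finset.range (J + 1), ‖u (n + j) x‖ * (y ^ j / j.factorial) +
        M (n + (J + 1)) * (y ^ (J + 1) / (J + 1).factorial))
      (B' := fun y => ∑ j ∈ Finset.range J, ‖u (n + 1 + j) x‖ * (y ^ j / j.factorial) +
        M (n + 1 + J) * (y ^ J / J.factorial))
      (fun y _ => ((hu n (x + y)).comp_const_add x y).continuousAt.continuousWithinAt)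
      (fun y _ => ((hu n (x + y)).comp_const_add x y).hasDerivWithinAt)
      (by simp [Finset.sum_range_succ']) (fun y => HasDerivAt.add ?_ ?_)
      (fun y hy => ih hy.1 (n + 1)) ⟨hh, le_rfl⟩
    · simp only [Finset.sum_range_succ', pow_zero, Nat.factorial_zero, Nat.cast_one, div_one,
        mul_one, add_zero, add_right_comm n 1, add_assoc n _ 1]
      exact (HasDerivAt.fun_sum fun j _ =>
        (hasDerivAt_pow_div_factorial j y).const_mul _).add_const _
    · rw [add_right_comm n 1, add_assoc n _ 1]
      exact (hasDerivAt_pow_div_factorial J y).const_mul _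

theorem norm_add_le_exp_mul (hu : ∀ n t, HasDerivAt (u n) (u (n + 1) t) t)
    (hM : ∀ n t, ‖u n t‖ ≤ M n) (hpos : ∀ n, 0 < M n)
    (hconv : ∀ n, M (n + 1) ^ 2 ≤ M n * M (n + 2)) {N : ℕ} {x h : ℝ} (hh : 0 ≤ h)
    (h_le : h ≤ M N / (Real.exp 1 * M (N + 1)))
    (hx : ∀ n ≤ N + 1, ‖u n x‖ ≤ Real.exp ((n : ℝ) - (N + 1 : ℕ)) * M n) {n : ℕ} (hn : n ≤ N) :
    ‖u n (x + h)‖ ≤ Real.exp ((n : ℝ) - N) * M n := by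
  set c := Real.exp ((n : ℝ) - (N + 1 : ℕ)) * M n
  have hM_mul : M (N + 1) * (Real.exp 1 * h) ≤ M N := by
    rw [le_div_iff₀ (mul_pos (Real.exp_pos 1) (hpos _))] at h_le
    linarith
  obtain ⟨J, hJ⟩ : ∃ J, n + J = N + 1 := ⟨N + 1 - n, by omega⟩
  have term_le (j : ℕ) (hj : j ≤ J) : Real.exp (((n + j : ℕ) : ℝ) - (N + 1 : ℕ)) * M (n + j) *
      (h ^ j / j.factorial) ≤ c * (1 ^ j / j.factorial) := by
    have hexp : Real.exp (((n + j : ℕ) : ℝ) - (N + 1 : ℕ)) =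
        Real.exp ((n : ℝ) - (N + 1 : ℕ)) * Real.exp 1 ^ j := by
      rw [← Real.exp_nat_mul, ← Real.exp_add]; congr 1; push_cast; ring
    calc _ = Real.exp ((n : ℝ) - (N + 1 : ℕ)) * (M (n + j) * (Real.exp 1 * h) ^ j) /
          j.factorial := by rw [hexp, mul_pow]; ring
      _ ≤ c / j.factorial := by
          have hnj : n + j ≤ N + 1 := by omega
          gcongr ?_ / _
          exact mul_le_mul_of_nonneg_left
            (mul_pow_le_of_sq_le_mul hpos hconv (by positivity) hM_mul hnj) (Real.exp_pos _).le
      _ = c * (1 ^ j / j.factorial) := by simp [div_eq_mul_inv]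
  calc ‖u n (x + h)‖
      ≤ ∑ j ∈ Finset.range J, ‖u (n + j) x‖ * (h ^ j / j.factorial) +
        M (n + J) * (h ^ J / J.factorial) := norm_add_le_taylor_sum hu hM x hh J n
    _ ≤ ∑ j ∈ Finset.range (J + 1), c * (1 ^ j / j.factorial) := by
      rw [Finset.sum_range_succ]
      refine add_le_add (Finset.sum_le_sum fun j hj => ?_) ?_
      · have hjJ := Finset.mem_range.1 hj
        refine le_trans ?_ (term_le j hjJ.le)
        gcongr
        exact hx _ (by omega)
      · simpa [hJ] using term_le J le_rfl
    _ = c * ∑ j ∈ Finset.range (J + 1), (1 : ℝ) ^ j / j.factorial := by rw [Finset.mul_sum]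
    _ ≤ c * Real.exp 1 := by
      have := hpos n
      gcongr
      exact Real.sum_le_exp_of_nonneg zero_le_one _
    _ = Real.exp ((n : ℝ) - N) * M n := by
      rw [mul_right_comm, ← Real.exp_add]; congr 2; push_cast; ring

theorem norm_le_exp_mul_of_le_sum (hu : ∀ n t, HasDerivAt (u n) (u (n + 1) t) t)
    (hM : ∀ n t, ‖u n t‖ ≤ M n) (hpos : ∀ n, 0 < M n)
    (hconv : ∀ n, M (n + 1) ^ 2 ≤ M n * M (n + 2)) (hflat : ∀ n, u n 0 = 0) (m N : ℕ) {x : ℝ}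
    (hx : 0 ≤ x) (hx_le : x ≤ ∑ i ∈ Finset.range m, M (i + N) / (Real.exp 1 * M (i + N + 1)))
    {n : ℕ} (hn : n ≤ N) : ‖u n x‖ ≤ Real.exp ((n : ℝ) - N) * M n := by
  have step_nonneg (i : ℕ) : 0 ≤ M i / (Real.exp 1 * M (i + 1)) :=
    div_nonneg (hpos i).le (mul_pos (Real.exp_pos 1) (hpos _)).le
  induction m generalizing N x n with
  | zero =>
    obtain rfl : x = 0 := le_antisymm (by simpa using hx_le) hx
    simpa [hflat] using mul_nonneg (Real.exp_pos _).le (hpos n).le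
  | succ m ih =>
    rw [Finset.sum_range_succ', zero_add] at hx_le
    set d := M N / (Real.exp 1 * M (N + 1))
    have split : x = max (x - d) 0 + min x d := by
      rcases le_total x d with h | h
      · rw [max_eq_right (by linarith), min_eq_left h, zero_add]
      · rw [max_eq_left (by linarith), min_eq_right h, sub_add_cancel]
    rw [split]
    refine norm_add_le_exp_mul hu hM hpos hconv (le_min hx (step_nonneg N)) (min_le_right _ _)
      (fun k hk => ih (N + 1) (le_max_right _ _) (max_le ?_ ?_) hk) hn
    · simpa only [add_right_comm, add_assoc] using sub_le_iff_le_add.2 hx_le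
    · exact Finset.sum_nonneg fun i _ => step_nonneg _

theorem eq_zero_of_flat_of_not_summable (hu : ∀ n t, HasDerivAt (u n) (u (n + 1) t) t)
    (hM : ∀ n t, ‖u n t‖ ≤ M n) (hpos : ∀ n, 0 < M n)
    (hconv : ∀ n, M (n + 1) ^ 2 ≤ M n * M (n + 2))
    (hdiv : ¬ Summable fun n => M n / M (n + 1)) (hflat : ∀ n, u n 0 = 0) {x : ℝ} (hx : 0 ≤ x) :
    u 0 x = 0 := by
  have step_eq (i : ℕ) : M i / (Real.exp 1 * M (i + 1)) = (Real.exp 1)⁻¹ * (M i / M (i + 1)) := by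
    field_simp
  have norm_le (N : ℕ) : ‖u 0 x‖ ≤ Real.exp (-(N : ℝ)) * M 0 := by
    have hdiv_shift : ¬ Summable fun i => M (i + N) / (Real.exp 1 * M (i + N + 1)) := by
      rw [summable_nat_add_iff (f := fun i => M i / (Real.exp 1 * M (i + 1))) N]
      simpa only [step_eq, summable_mul_left_iff (inv_ne_zero (Real.exp_ne_zero 1))] using hdiv
    have hsum := (not_summable_iff_tendsto_nat_atTop_of_nonneg fun i =>
      div_nonneg (hpos _).le (mul_pos (Real.exp_pos 1) (hpos _)).le).1 hdiv_shift
    obtain ⟨m, hm⟩ := (hsum.eventually_ge_atTop x).exists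
    simpa using norm_le_exp_mul_of_le_sum hu hM hpos hconv hflat m N hx hm N.zero_le
  have hlim : Tendsto (fun N : ℕ => Real.exp (-(N : ℝ)) * M 0) atTop (𝓝 0) := by
    simpa using
      (Real.tendsto_exp_neg_atTop_nhds_zero.comp tendsto_natCast_atTop_atTop).mul_const (M 0)
  exact norm_le_zero_iff.1 (ge_of_tendsto' hlim norm_le)

end Bang

/-! ### Determinacy of discrete moment sequences -/

section CosineSeries

variable {ι E : Type*} [NormedAddCommGroup E] [NormedSpace ℝ E] {s : ι → ℝ} {b : ι → E}

theorem tendsto_inv_mul_integral_cos (c : ℝ) :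
    Tendsto (fun T : ℝ => T⁻¹ * ∫ t in (0 : ℝ)..T, Real.cos (c * t)) atTop
      (𝓝 (if c = 0 then 1 else 0)) := by
  split_ifs with hc
  · refine tendsto_const_nhds.congr' ?_
    filter_upwards [eventually_gt_atTop 0] with T hT
    simp [hc, hT.ne']
  · have integral_eq (T : ℝ) : ∫ t in (0 : ℝ)..T, Real.cos (c * t) = c⁻¹ * Real.sin (c * T) := by
      simp [intervalIntegral.integral_comp_mul_left (fun t => Real.cos t) hc]
    simp_rw [integral_eq]
    refine squeeze_zero_norm (a := fun T : ℝ => |c⁻¹| * |T⁻¹|) (fun T => ?_)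
      (by simpa using (tendsto_inv_atTop_zero (𝕜 := ℝ)).abs.const_mul |c⁻¹|)
    rw [Real.norm_eq_abs, abs_mul, abs_mul, mul_comm]
    gcongr
    exact mul_le_of_le_one_right (abs_nonneg _) (Real.abs_sin_le_one _)

/-- The mean value over `[0, T]` of the product of the cosines of frequencies `s` and `σ`. -/
noncomputable def cosMean (s σ T : ℝ) : ℝ :=
  T⁻¹ * ∫ t in (0 : ℝ)..T, Real.cos (s * t) * Real.cos (σ * t)

theorem abs_cos_mul_cos_le_one (x y : ℝ) : |Real.cos x * Real.cos y| ≤ 1 := by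
  rw [abs_mul]
  exact mul_le_one₀ (Real.abs_cos_le_one x) (abs_nonneg _) (Real.abs_cos_le_one y)

theorem abs_cosMean_le_one (s σ : ℝ) {T : ℝ} (hT : 0 < T) : |cosMean s σ T| ≤ 1 := by
  have h := intervalIntegral.norm_integral_le_of_norm_le_const (a := 0) (b := T) (C := 1)
    (f := fun t => Real.cos (s * t) * Real.cos (σ * t)) fun t _ => abs_cos_mul_cos_le_one _ _
  rw [sub_zero, one_mul, abs_of_pos hT] at h
  rw [cosMean, abs_mul, abs_inv, abs_of_pos hT, inv_mul_le_one₀ hT]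
  exact h

theorem tendsto_cosMean {s σ : ℝ} (hs : 0 ≤ s) (hσ : 0 ≤ σ) :
    Tendsto (cosMean s σ) atTop
      (𝓝 ((if s = σ then 1 else 0) * ((1 + if σ = 0 then 1 else 0) / 2))) := by
  have limit_eq : (if s = σ then (1 : ℝ) else 0) * ((1 + if σ = 0 then 1 else 0) / 2) =
      ((if s - σ = 0 then 1 else 0) + if s + σ = 0 then 1 else 0) / 2 := by
    rcases eq_or_ne s σ with rfl | hne
    · simp
    · have hadd : s + σ ≠ 0 := fun h => hne (by linarith)
      simp [hne, sub_ne_zero.2 hne, hadd]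
  rw [limit_eq]
  refine (((tendsto_inv_mul_integral_cos (s - σ)).add
    (tendsto_inv_mul_integral_cos (s + σ))).div_const 2).congr fun T => ?_
  rw [← mul_add, ← intervalIntegral.integral_add
    (Continuous.intervalIntegrable (by fun_prop) _ _)
    (Continuous.intervalIntegrable (by fun_prop) _ _), mul_div_assoc,
    ← intervalIntegral.integral_div, cosMean]
  congr 2
  ext t
  rw [sub_mul, add_mul, ← Real.two_mul_cos_mul_cos]
  ring

theorem hasSum_cosMean_smul [Countable ι] [CompleteSpace E] (hb : Summable fun k => ‖b k‖)
    (hzero : ∀ t ≥ 0, HasSum (fun k => Real.cos (s k * t) • b k) 0) (σ : ℝ) {T : ℝ} (hT : 0 ≤ T) :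
    HasSum (fun k => cosMean (s k) σ T • b k) 0 := by
  have hintegral : HasSum
      (fun k => ∫ t in (0 : ℝ)..T, (Real.cos (s k * t) * Real.cos (σ * t)) • b k)
      (∫ _ in (0 : ℝ)..T, (0 : E)) := by
    refine intervalIntegral.hasSum_integral_of_dominated_convergence (fun k _ => ‖b k‖)
      (fun k => Continuous.aestronglyMeasurable (by fun_prop)) (fun k => .of_forall fun t _ => ?_)
      (.of_forall fun t _ => hb) (by simp) (.of_forall fun t ht => ?_)
    · rw [norm_smul, Real.norm_eq_abs]
      exact mul_le_of_le_one_left (norm_nonneg _) (abs_cos_mul_cos_le_one _ _)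
    · rw [uIoc_of_le hT] at ht
      simpa only [smul_smul, mul_comm (Real.cos (σ * t)), smul_zero] using
        (hzero t ht.1.le).const_smul (Real.cos (σ * t))
  simpa only [cosMean, intervalIntegral.integral_smul_const, smul_smul,
    intervalIntegral.integral_zero, smul_zero] using hintegral.const_smul T⁻¹

theorem tsum_fiber_eq_zero_of_hasSum_cos_smul [Countable ι] [CompleteSpace E] (hs : ∀ k, 0 ≤ s k)
    (hb : Summable fun k => ‖b k‖)
    (hzero : ∀ t ≥ 0, HasSum (fun k => Real.cos (s k * t) • b k) 0) {σ : ℝ} (hσ : 0 ≤ σ) :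
    ∑' k : s ⁻¹' {σ}, b k = 0 := by
  set κ : ℝ := (1 + if σ = 0 then 1 else 0) / 2
  have hκ : κ ≠ 0 := by simp only [κ]; split_ifs <;> norm_num
  have hlim : Tendsto (fun T : ℝ => ∑' k, cosMean (s k) σ T • b k) atTop
      (𝓝 (∑' k, ((if s k = σ then 1 else 0) * κ) • b k)) := by
    refine tendsto_tsum_of_dominated_convergence hb
      (fun k => (tendsto_cosMean (hs k) hσ).smul_const (b k)) ?_
    filter_upwards [eventually_gt_atTop 0] with T hT k
    rw [norm_smul]
    exact mul_le_of_le_one_left (norm_nonneg _) (abs_cosMean_le_one _ _ hT)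
  have hlim_zero : Tendsto (fun T : ℝ => ∑' k, cosMean (s k) σ T • b k) atTop (𝓝 0) := by
    refine tendsto_const_nhds.congr' ?_
    filter_upwards [eventually_ge_atTop 0] with T hT
      using (hasSum_cosMean_smul hb hzero σ hT).tsum_eq.symm
  have term_eq (k : ι) : ((if s k = σ then 1 else 0) * κ) • b k =
      κ • (s ⁻¹' {σ}).indicator b k := by
    by_cases h : s k = σ <;> simp [indicator, h]
  have hsum := tendsto_nhds_unique hlim hlim_zero
  simp_rw [term_eq, tsum_const_smul''] at hsum
  rw [tsum_subtype]
  exact (smul_eq_zero.1 hsum).resolve_left hκ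

end CosineSeries

section Moments

variable {ι E : Type*} [NormedAddCommGroup E] {s : ι → ℝ} {b : ι → E}

/-- The `n`-th absolute moment of the discrete vector measure with mass `b k` at `s k`. -/
noncomputable def absMoment (s : ι → ℝ) (b : ι → E) (n : ℕ) : ℝ :=
  ∑' k, s k ^ n * ‖b k‖

theorem summable_pow_mul_norm_of_even (hs : ∀ k, 0 ≤ s k)
    (hsum : ∀ m : ℕ, Summable fun k => s k ^ (2 * m) * ‖b k‖) (n : ℕ) :
    Summable fun k => s k ^ n * ‖b k‖ := by
  obtain ⟨m, rfl | rfl⟩ := n.even_or_odd'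
  · exact hsum m
  · refine Summable.of_nonneg_of_le (fun k => mul_nonneg (pow_nonneg (hs k) _) (norm_nonneg _))
      (fun k => ?_) ((hsum m).add (hsum (m + 1)))
    rw [← add_mul]
    gcongr
    calc s k ^ (2 * m + 1) = s k ^ (2 * m) * s k := pow_succ _ _
      _ ≤ s k ^ (2 * m) * (1 + s k ^ 2) := by
        gcongr
        · exact pow_nonneg (hs k) _
        · nlinarith [sq_nonneg (s k - 1)]
      _ = s k ^ (2 * m) + s k ^ (2 * (m + 1)) := by ring

theorem absMoment_pos (hs : ∀ k, 0 ≤ s k) {n : ℕ} (hsum : Summable fun k => s k ^ n * ‖b k‖)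
    {k : ι} (hk : s k ≠ 0) (hbk : b k ≠ 0) : 0 < absMoment s b n :=
  hsum.tsum_pos (fun k => mul_nonneg (pow_nonneg (hs k) _) (norm_nonneg _)) k
    (mul_pos (pow_pos ((hs k).lt_of_ne' hk) _) (norm_pos_iff.2 hbk))

theorem absMoment_sq_le (hs : ∀ k, 0 ≤ s k) (hsum : ∀ n : ℕ, Summable fun k => s k ^ n * ‖b k‖)
    (n : ℕ) : absMoment s b (n + 1) ^ 2 ≤ absMoment s b n * absMoment s b (n + 2) := by
  have quadratic_nonneg (x : ℝ) : 0 ≤ absMoment s b n * (x * x) +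
      (-2 * absMoment s b (n + 1)) * x + absMoment s b (n + 2) := by
    simp only [absMoment]
    rw [← tsum_mul_right, ← tsum_mul_left, ← tsum_mul_right,
      ← ((hsum n).mul_right _).tsum_add (((hsum (n + 1)).mul_left _).mul_right _),
      ← (((hsum n).mul_right _).add (((hsum (n + 1)).mul_left _).mul_right _)).tsum_add
        (hsum (n + 2))]
    refine tsum_nonneg fun k => ?_
    have := mul_nonneg (mul_nonneg (pow_nonneg (hs k) n) (norm_nonneg (b k))) (sq_nonneg (x - s k))
    linear_combination this
  have := discrim_le_zero quadratic_nonneg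
  rw [discrim] at this
  linarith

end Moments

section CosineTransform

variable {ι E : Type*} [NormedAddCommGroup E] [NormedSpace ℝ E] {s : ι → ℝ} {b : ι → E}

/-- The `n`-th derivative of the cosine transform `t ↦ ∑ₖ cos (sₖ t) bₖ` of the discrete vector
measure with mass `b k` at `s k`. -/
noncomputable def cosTransformDeriv (s : ι → ℝ) (b : ι → E) (n : ℕ) (t : ℝ) : E :=
  ∑' k, (Real.cos (s k * t + n * (Real.pi / 2)) * s k ^ n) • b k

theorem norm_cos_mul_pow_smul_le (hs : ∀ k, 0 ≤ s k) (n : ℕ) (x : ℝ) (k : ι) :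
    ‖(Real.cos x * s k ^ n) • b k‖ ≤ s k ^ n * ‖b k‖ := by
  rw [norm_smul, norm_mul, norm_pow, Real.norm_eq_abs, Real.norm_eq_abs, abs_of_nonneg (hs k)]
  gcongr
  exact mul_le_of_le_one_left (pow_nonneg (hs k) n) (Real.abs_cos_le_one x)

theorem norm_cosTransformDeriv_le (hs : ∀ k, 0 ≤ s k) {n : ℕ}
    (hsum : Summable fun k => s k ^ n * ‖b k‖) (t : ℝ) :
    ‖cosTransformDeriv s b n t‖ ≤ absMoment s b n :=
  tsum_of_norm_bounded hsum.hasSum fun k => norm_cos_mul_pow_smul_le hs n _ k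

theorem hasDerivAt_cosTransformDeriv [CompleteSpace E] (hs : ∀ k, 0 ≤ s k)
    (hsum : ∀ n : ℕ, Summable fun k => s k ^ n * ‖b k‖) (n : ℕ) (t : ℝ) :
    HasDerivAt (cosTransformDeriv s b n) (cosTransformDeriv s b (n + 1) t) t := by
  refine hasDerivAt_tsum (hsum (n + 1)) (y₀ := 0)
    (g := fun k t => (Real.cos (s k * t + n * (Real.pi / 2)) * s k ^ n) • b k)
    (g' := fun k t => (Real.cos (s k * t + (n + 1 : ℕ) * (Real.pi / 2)) * s k ^ (n + 1)) • b k)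
    (fun k y => ?_) (fun k y => norm_cos_mul_pow_smul_le hs (n + 1) _ k)
    (.of_norm_bounded (hsum n) fun k => norm_cos_mul_pow_smul_le hs n _ k) t
  have phase : s k * y + ((n + 1 : ℕ) : ℝ) * (Real.pi / 2) =
      s k * y + n * (Real.pi / 2) + Real.pi / 2 := by push_cast; ring
  have hlinear : HasDerivAt (fun y => s k * y + n * (Real.pi / 2)) (s k * 1) y :=
    ((hasDerivAt_id y).const_mul (s k)).add_const _
  refine ((hlinear.cos.mul_const (s k ^ n)).smul_const (b k)).congr_deriv ?_
  rw [phase, Real.cos_add_pi_div_two]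
  congr 1
  ring

theorem cosTransformDeriv_zero_eq_zero (hmoment : ∀ m : ℕ, ∑' k, s k ^ (2 * m) • b k = 0) (n : ℕ) :
    cosTransformDeriv s b n 0 = 0 := by
  obtain ⟨m, rfl | rfl⟩ := n.even_or_odd'
  · have phase : ((2 * m : ℕ) : ℝ) * (Real.pi / 2) = m * Real.pi := by push_cast; ring
    simp only [cosTransformDeriv, mul_zero, zero_add, phase, mul_smul, tsum_const_smul'', hmoment,
      smul_zero]
  · have phase : ((2 * m + 1 : ℕ) : ℝ) * (Real.pi / 2) = m * Real.pi + Real.pi / 2 := by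
      push_cast; ring
    simp only [cosTransformDeriv, mul_zero, zero_add, phase, Real.cos_add_pi_div_two,
      Real.sin_nat_mul_pi, neg_zero, zero_mul, zero_smul, tsum_zero]

end CosineTransform

section Carleman

open scoped ENNReal

theorem tsum_rpow_neg_eq_top_of_le_mul {ι : Type*} {L L' : ι → ℝ≥0∞} {p : ι → ℝ}
    (hp : ∀ i, p i ∈ Icc 0 1) {C : ℝ≥0∞} (hC : C ≠ ⊤) (hle : ∀ i, L' i ≤ C * L i)
    (hL : ∑' i, L i ^ (-p i) = ⊤) : ∑' i, L' i ^ (-p i) = ⊤ := by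
  set D := max C 1
  have hD : D ≠ ⊤ := by simp [D, hC]
  have hD_one : 1 ≤ D := le_max_right C 1
  have inv_mul_rpow_le (i : ι) : D⁻¹ * L i ^ (-p i) ≤ L' i ^ (-p i) := by
    have hDp_le : D ^ p i ≤ D := by
      simpa using ENNReal.rpow_le_rpow_of_exponent_le hD_one (hp i).2
    rw [ENNReal.rpow_neg, ENNReal.rpow_neg, ← ENNReal.mul_inv (.inl (one_pos.trans_le hD_one).ne')
      (.inl hD), ENNReal.inv_le_inv]
    calc L' i ^ p i ≤ (D * L i) ^ p i := by
          have := (hle i).trans (mul_le_mul_left (le_max_left C 1) (L i))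
          exact ENNReal.rpow_le_rpow this (hp i).1
      _ = D ^ p i * L i ^ p i := ENNReal.mul_rpow_of_nonneg _ _ (hp i).1
      _ ≤ D * L i ^ p i := by gcongr
  rw [eq_top_iff, ← ENNReal.mul_top (ENNReal.inv_ne_zero.2 hD), ← hL, ← ENNReal.tsum_mul_left]
  exact ENNReal.tsum_le_tsum inv_mul_rpow_le

theorem not_summable_ratio_of_tsum_rpow_eq_top {M : ℕ → ℝ} (hM : ∀ n, 0 < M n)
    (hcarleman : ∑' m : ℕ, ENNReal.ofReal (M (2 * (m + 1))) ^ (-(1 / (2 * ((m : ℝ) + 1)))) = ⊤) :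
    ¬ Summable fun n => M n / M (n + 1) := by
  intro hratio
  have hodd : Function.Injective fun m : ℕ => 2 * m + 1 := fun x y h => by simpa using h
  have hroots := (summable_rpow_of_summable_ratio hM hratio).comp_injective hodd
  refine hroots.tsum_ofReal_ne_top ?_
  have hnormalized := tsum_rpow_neg_eq_top_of_le_mul
    (L' := fun m => ENNReal.ofReal (M (2 * (m + 1)) / M 0)) (C := ENNReal.ofReal (M 0)⁻¹)
    (fun m : ℕ => ⟨by positivity, ?_⟩) ENNReal.ofReal_ne_top (fun m => ?_) hcarleman
  · rw [← hnormalized]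
    refine tsum_congr fun m => ?_
    have exponent : (1 : ℝ) / ((2 * m + 1 : ℕ) + 1) = 1 / (2 * ((m : ℝ) + 1)) := by
      push_cast; ring
    have hpos := div_pos (hM (2 * (m + 1))) (hM 0)
    rw [ENNReal.ofReal_rpow_of_pos hpos, Function.comp, exponent, Real.rpow_neg hpos.le,
      ← Real.inv_rpow hpos.le, inv_div]
    rfl
  · rw [div_le_one (by positivity)]
    linarith [(m.cast_nonneg : (0 : ℝ) ≤ m)]
  · rw [← ENNReal.ofReal_mul (inv_nonneg.2 (hM 0).le), div_eq_inv_mul]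

variable {ι E : Type*} [NormedAddCommGroup E] [NormedSpace ℝ E] [CompleteSpace E] {b : ι → E}

theorem hasSum_cos_smul_zero_of_moments {s : ι → ℝ} (hs : ∀ k, 0 ≤ s k)
    (hsum : ∀ n : ℕ, Summable fun k => s k ^ n * ‖b k‖)
    (hmoment : ∀ m : ℕ, ∑' k, s k ^ (2 * m) • b k = 0)
    (hcarleman :
      ∑' m : ℕ, ENNReal.ofReal (absMoment s b (2 * (m + 1))) ^ (-(1 / (2 * ((m : ℝ) + 1)))) = ⊤)
    {t : ℝ} (ht : 0 ≤ t) : HasSum (fun k => Real.cos (s k * t) • b k) 0 := by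
  have hsum_cos : Summable fun k => Real.cos (s k * t) • b k :=
    .of_norm_bounded (hsum 0) fun k => by simpa using norm_cos_mul_pow_smul_le hs 0 (s k * t) k
  rw [hsum_cos.hasSum_iff]
  by_cases hdegenerate : ∀ k, s k = 0 ∨ b k = 0
  · rw [← hmoment 0]
    refine tsum_congr fun k => ?_
    rcases hdegenerate k with h | h <;> simp [h]
  push Not at hdegenerate
  obtain ⟨k, hk, hbk⟩ := hdegenerate
  have hpos (n : ℕ) : 0 < absMoment s b n := absMoment_pos hs (hsum n) hk hbk
  simpa [cosTransformDeriv] using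
    eq_zero_of_flat_of_not_summable (hasDerivAt_cosTransformDeriv hs hsum)
      (fun n => norm_cosTransformDeriv_le hs (hsum n)) hpos (absMoment_sq_le hs hsum)
      (not_summable_ratio_of_tsum_rpow_eq_top hpos hcarleman)
      (cosTransformDeriv_zero_eq_zero hmoment) ht

theorem tsum_fiber_eq_zero_of_moments [Countable ι] {x : ι → ℝ} (hx : ∀ k, 0 ≤ x k)
    (hsum : ∀ m : ℕ, Summable fun k => x k ^ m * ‖b k‖)
    (hmoment : ∀ m : ℕ, ∑' k, x k ^ m • b k = 0)
    (hcarleman :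
      ∑' m : ℕ, ENNReal.ofReal (absMoment x b (m + 1)) ^ (-(1 / (2 * ((m : ℝ) + 1)))) = ⊤)
    (y : ℝ) : ∑' k : x ⁻¹' {y}, b k = 0 := by
  have sqrt_pow (k : ι) (m : ℕ) : √(x k) ^ (2 * m) = x k ^ m := by rw [pow_mul, Real.sq_sqrt (hx k)]
  have hsum_sqrt := summable_pow_mul_norm_of_even (s := fun k => √(x k)) (b := b)
    (fun k => (x k).sqrt_nonneg) (by simpa only [sqrt_pow] using hsum)
  rcases lt_or_ge y 0 with hneg | hy
  · have : IsEmpty (x ⁻¹' {y}) := ⟨fun k => ((hx k).trans_eq k.2).not_gt hneg⟩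
    exact tsum_empty
  have fiber_eq : x ⁻¹' {y} = (fun k => √(x k)) ⁻¹' {√y} := by
    ext k
    simp [Real.sqrt_inj (hx k) hy]
  rw [fiber_eq]
  refine tsum_fiber_eq_zero_of_hasSum_cos_smul (fun k => (x k).sqrt_nonneg)
    (by simpa using hsum_sqrt 0) (fun t ht => ?_) y.sqrt_nonneg
  refine hasSum_cos_smul_zero_of_moments (fun k => (x k).sqrt_nonneg) hsum_sqrt
    (by simpa only [sqrt_pow] using hmoment) ?_ ht
  simpa only [absMoment, sqrt_pow] using hcarleman

end Carleman

/-! ### Interior estimates for elliptic operators -/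

section Derivatives

open scoped ContDiff

variable {E : Type*} [NormedAddCommGroup E] [NormedSpace ℝ E] {n j : ℕ} {u : ℝ → E} {s : Set ℝ}

theorem hasDerivAt_iteratedDeriv (hs : IsOpen s) (hu : ContDiffOn ℝ n u s) (hj : j < n) {x : ℝ}
    (hx : x ∈ s) : HasDerivAt (iteratedDeriv j u) (iteratedDeriv (j + 1) u x) x := by
  have hwithin : DifferentiableOn ℝ (iteratedDerivWithin j u s) s :=
    hu.differentiableOn_iteratedDerivWithin (mod_cast hj) hs.uniqueDiffOn
  have hdiff : DifferentiableAt ℝ (iteratedDeriv j u) x :=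
    ((hwithin.congr fun y hy => (iteratedDerivWithin_of_isOpen hs hy).symm) x hx).differentiableAt
      (hs.mem_nhds hx)
  rw [iteratedDeriv_succ]
  exact hdiff.hasDerivAt

theorem continuousOn_iteratedDeriv (hs : IsOpen s) (hu : ContDiffOn ℝ n u s) (hj : j ≤ n) :
    ContinuousOn (iteratedDeriv j u) s :=
  (hu.continuousOn_iteratedDerivWithin (mod_cast hj) hs.uniqueDiffOn).congr
    fun _ hx => (iteratedDerivWithin_of_isOpen hs hx).symm

variable {α β : ℝ}

theorem intervalIntegrable_iteratedDeriv (hs : IsOpen s) (hu : ContDiffOn ℝ n u s) (hj : j ≤ n)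
    (hαβs : uIcc α β ⊆ s) : IntervalIntegrable (iteratedDeriv j u) volume α β :=
  ((continuousOn_iteratedDeriv hs hu hj).mono hαβs).intervalIntegrable

variable [CompleteSpace E] {η : ℝ → ℝ}

theorem integral_smul_iteratedDeriv (hs : IsOpen s) (hu : ContDiffOn ℝ n u s) (hαβ : α ≤ β)
    (hαβs : Icc α β ⊆ s) (hη : ContDiff ℝ ∞ η) (hsupp : tsupport η ⊆ Ioo α β) (hj : j ≤ n) :
    ∫ x in α..β, η x • iteratedDeriv j u x =
      (-1 : ℝ) ^ j • ∫ x in α..β, iteratedDeriv j η x • u x := by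
  induction j generalizing η with
  | zero => simp
  | succ j ih =>
    have hη' : ContDiff ℝ ∞ (deriv η) := (contDiff_infty_iff_deriv.1 hη).2
    have hsupp' : tsupport (deriv η) ⊆ Ioo α β :=
      (closure_minimal support_deriv_subset (isClosed_tsupport η)).trans hsupp
    have boundary {x : ℝ} (hx : x ∉ Ioo α β) : η x = 0 :=
      image_eq_zero_of_notMem_tsupport fun h => hx (hsupp h)
    have hηdiff : Differentiable ℝ η := hη.differentiable (by simp)
    have uIcc_subset : uIcc α β ⊆ s := by rwa [uIcc_of_le hαβ]
    rw [intervalIntegral.integral_smul_deriv_eq_deriv_smul_of_hasDerivAt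
      (v := iteratedDeriv j u) (u' := deriv η) hηdiff.continuous.continuousOn
      ((continuousOn_iteratedDeriv hs hu (by omega)).mono uIcc_subset)
      (fun x _ => (hηdiff x).hasDerivAt)
      (fun x hx => hasDerivAt_iteratedDeriv hs hu (by omega)
        (uIcc_subset (Ioo_subset_Icc_self hx)))
      (hη'.continuous.intervalIntegrable _ _)
      (intervalIntegrable_iteratedDeriv hs hu hj uIcc_subset),
      boundary (by simp), boundary (by simp), ih hη' hsupp' (by omega), iteratedDeriv_succ']
    simp [pow_succ]

theorem exists_norm_integral_smul_iteratedDeriv_le (hs : IsOpen s) (hαβ : α ≤ β)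
    (hαβs : Icc α β ⊆ s) (hη : ContDiff ℝ ∞ η) (hsupp : tsupport η ⊆ Ioo α β) (hj : j ≤ n) :
    ∃ K ≥ 0, ∀ u : ℝ → E, ContDiffOn ℝ n u s →
      ‖∫ x in α..β, η x • iteratedDeriv j u x‖ ≤ K * ∫ x in α..β, ‖u x‖ := by
  obtain ⟨K, hK⟩ := isCompact_Icc.exists_bound_of_continuousOn
    ((hη.continuous_iteratedDeriv j (mod_cast le_top)).continuousOn (s := Icc α β))
  refine ⟨K, (norm_nonneg _).trans (hK α ⟨le_rfl, hαβ⟩), fun u hu => ?_⟩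
  rw [integral_smul_iteratedDeriv hs hu hαβ hαβs hη hsupp hj, norm_smul, norm_pow, norm_neg,
    norm_one, one_pow, one_mul, ← intervalIntegral.integral_const_mul]
  refine intervalIntegral.norm_integral_le_of_norm_le hαβ (.of_forall fun x hx => ?_)
    ((hu.continuousOn.mono hαβs).norm.const_mul K |>.intervalIntegrable_of_Icc hαβ)
  rw [norm_smul]
  gcongr
  exact hK x (Ioc_subset_Icc_self hx)

theorem exists_contDiff_tsupport_subset_integral_eq_one (hαβ : α < β) :
    ∃ η : ℝ → ℝ, ContDiff ℝ ∞ η ∧ tsupport η ⊆ Ioo α β ∧ (∀ x, 0 ≤ η x) ∧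
      ∫ x in α..β, η x = 1 := by
  let φ : ContDiffBump ((α + β) / 2) := ⟨(β - α) / 8, (β - α) / 4, by linarith, by linarith⟩
  have hsupp : tsupport (φ.normed volume) ⊆ Ioo α β := by
    rw [φ.tsupport_normed_eq, Real.closedBall_eq_Icc]
    change Icc ((α + β) / 2 - (β - α) / 4) ((α + β) / 2 + (β - α) / 4) ⊆ Ioo α β
    exact fun x hx => ⟨by linarith [hx.1], by linarith [hx.2]⟩
  refine ⟨φ.normed volume, φ.contDiff_normed, hsupp, φ.nonneg_normed, ?_⟩
  rw [intervalIntegral.integral_eq_integral_of_support_subset, φ.integral_normed]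
  exact (subset_tsupport _).trans (hsupp.trans Ioo_subset_Ioc_self)

theorem norm_sub_le_integral_norm_deriv {v v' : ℝ → E} (hv : ∀ x ∈ Icc α β, HasDerivAt v (v' x) x)
    (hv' : ContinuousOn v' (Icc α β)) {x y : ℝ} (hx : x ∈ Icc α β) (hy : y ∈ Icc α β) :
    ‖v x - v y‖ ≤ ∫ z in α..β, ‖v' z‖ := by
  have hαβ : α ≤ β := hx.1.trans hx.2
  have huIcc : uIcc y x ⊆ Icc α β := uIcc_subset_Icc hy hx
  rw [← intervalIntegral.integral_eq_sub_of_hasDerivAt (fun z hz => hv z (huIcc hz))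
    (hv'.mono huIcc).intervalIntegrable]
  refine intervalIntegral.norm_integral_le_integral_norm_uIoc.trans ?_
  rw [intervalIntegral.integral_of_le hαβ]
  exact setIntegral_mono_set (hv'.norm.integrableOn_Icc.mono_set Ioc_subset_Icc_self)
    (.of_forall fun _ => norm_nonneg _)
    (.of_forall (Ioc_subset_Ioc (le_min hy.1 hx.1) (max_le hy.2 hx.2)))

theorem norm_le_norm_integral_smul_add {v v' : ℝ → E} (hη : Continuous η) (hη_nonneg : ∀ x, 0 ≤ η x)
    (hη_one : ∫ x in α..β, η x = 1) (hv : ∀ x ∈ Icc α β, HasDerivAt v (v' x) x)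
    (hv' : ContinuousOn v' (Icc α β)) {x : ℝ} (hx : x ∈ Icc α β) :
    ‖v x‖ ≤ ‖∫ y in α..β, η y • v y‖ + ∫ y in α..β, ‖v' y‖ := by
  have hαβ : α ≤ β := hx.1.trans hx.2
  have hvc : ContinuousOn v (Icc α β) := fun y hy => (hv y hy).continuousAt.continuousWithinAt
  have decomposition :
      v x = (∫ y in α..β, η y • v y) + ∫ y in α..β, η y • (v x - v y) := by
    have hmean : IntervalIntegrable (fun y => η y • v y) volume α β :=
      (hη.continuousOn.smul hvc).intervalIntegrable_of_Icc hαβ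
    have hdiff : IntervalIntegrable (fun y => η y • (v x - v y)) volume α β :=
      (hη.continuousOn.smul (continuousOn_const.sub hvc)).intervalIntegrable_of_Icc hαβ
    rw [← intervalIntegral.integral_add hmean hdiff]
    simp_rw [← smul_add, add_sub_cancel]
    rw [intervalIntegral.integral_smul_const, hη_one, one_smul]
  have oscillation : ‖∫ y in α..β, η y • (v x - v y)‖ ≤ ∫ y in α..β, ‖v' y‖ := by
    calc ‖∫ y in α..β, η y • (v x - v y)‖
        ≤ ∫ y in α..β, η y * ∫ z in α..β, ‖v' z‖ := by
          refine intervalIntegral.norm_integral_le_of_norm_le hαβ (.of_forall fun y hy => ?_)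
            ((hη.mul continuous_const).intervalIntegrable _ _)
          rw [norm_smul, Real.norm_of_nonneg (hη_nonneg y)]
          exact mul_le_mul_of_nonneg_left
            (norm_sub_le_integral_norm_deriv hv hv' hx (Ioc_subset_Icc_self hy)) (hη_nonneg y)
      _ = ∫ y in α..β, ‖v' y‖ := by
          rw [intervalIntegral.integral_mul_const, hη_one, one_mul]
  calc ‖v x‖ = ‖(∫ y in α..β, η y • v y) + ∫ y in α..β, η y • (v x - v y)‖ := by
        rw [← decomposition]
    _ ≤ ‖∫ y in α..β, η y • v y‖ + ∫ y in α..β, ‖v' y‖ :=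
        (norm_add_le _ _).trans (by gcongr)

theorem exists_norm_iteratedDeriv_le_integral_succ (hs : IsOpen s) (hαβ : α < β)
    (hαβs : Icc α β ⊆ s) (hj : j < n) :
    ∃ K ≥ 0, ∀ u : ℝ → E, ContDiffOn ℝ n u s → ∀ x ∈ Icc α β, ‖iteratedDeriv j u x‖ ≤
      K * (∫ y in α..β, ‖u y‖) + ∫ y in α..β, ‖iteratedDeriv (j + 1) u y‖ := by
  obtain ⟨η, hη, hsupp, hη_nonneg, hη_one⟩ := exists_contDiff_tsupport_subset_integral_eq_one hαβ
  obtain ⟨K, hK_nonneg, hK⟩ :=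
    exists_norm_integral_smul_iteratedDeriv_le (E := E) hs hαβ.le hαβs hη hsupp hj.le
  refine ⟨K, hK_nonneg, fun u hu x hx => ?_⟩
  refine (norm_le_norm_integral_smul_add hη.continuous hη_nonneg hη_one
    (fun y hy => hasDerivAt_iteratedDeriv hs hu hj (hαβs hy))
    ((continuousOn_iteratedDeriv hs hu hj).mono hαβs) hx).trans ?_
  gcongr
  exact hK u hu

theorem exists_norm_iteratedDeriv_le_integral_top (hs : IsOpen s) (hαβ : α < β)
    (hαβs : Icc α β ⊆ s) (hlength : β - α ≤ 1) (hj : j < n) :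
    ∃ K ≥ 0, ∀ u : ℝ → E, ContDiffOn ℝ n u s → ∀ x ∈ Icc α β, ‖iteratedDeriv j u x‖ ≤
      K * (∫ y in α..β, ‖u y‖) + ∫ y in α..β, ‖iteratedDeriv n u y‖ := by
  induction hd : n - (j + 1) generalizing j with
  | zero =>
    obtain rfl : n = j + 1 := by omega
    exact exists_norm_iteratedDeriv_le_integral_succ hs hαβ hαβs hj
  | succ d ih =>
    obtain ⟨K, hK_nonneg, hK⟩ :=
      exists_norm_iteratedDeriv_le_integral_succ (E := E) hs hαβ hαβs hj
    have hj' : j + 1 < n := by omega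
    obtain ⟨L, hL_nonneg, hL⟩ := ih hj' (by omega)
    refine ⟨K + L, by positivity, fun u hu x hx => (hK u hu x hx).trans ?_⟩
    have hu_nonneg : 0 ≤ ∫ y in α..β, ‖u y‖ :=
      intervalIntegral.integral_nonneg hαβ.le fun _ _ => norm_nonneg _
    have hun_nonneg : 0 ≤ ∫ y in α..β, ‖iteratedDeriv n u y‖ :=
      intervalIntegral.integral_nonneg hαβ.le fun _ _ => norm_nonneg _
    set M := L * (∫ y in α..β, ‖u y‖) + ∫ y in α..β, ‖iteratedDeriv n u y‖
    have hsucc : ∫ y in α..β, ‖iteratedDeriv (j + 1) u y‖ ≤ M :=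
      calc ∫ y in α..β, ‖iteratedDeriv (j + 1) u y‖ ≤ ∫ _ in α..β, M :=
            intervalIntegral.integral_mono_on hαβ.le
              (intervalIntegrable_iteratedDeriv hs hu hj'.le (by rwa [uIcc_of_le hαβ.le])).norm
              intervalIntegrable_const (hL u hu)
        _ = (β - α) * M := by simp
        _ ≤ M := mul_le_of_le_one_left (by positivity) hlength
    linarith

end Derivatives

section Elliptic

variable {n : ℕ} {a : ℕ → ℝ → ℂ} {c d α β C Q : ℝ}

theorem exists_sum_norm_iteratedDeriv_le_integral_top {E : Type*} [NormedAddCommGroup E]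
    [NormedSpace ℝ E] [CompleteSpace E] {s : Set ℝ} (hs : IsOpen s) (hαβ : α < β)
    (hαβs : Icc α β ⊆ s) (hlength : β - α ≤ 1) :
    ∃ K ≥ 0, ∀ u : ℝ → E, ContDiffOn ℝ n u s → ∀ x ∈ Icc α β,
      ∑ j ∈ Finset.range n, ‖iteratedDeriv j u x‖ ≤
        K * (∫ y in α..β, ‖u y‖) + n * ∫ y in α..β, ‖iteratedDeriv n u y‖ := by
  choose! K hK_nonneg hK using fun j (hj : j < n) =>
    exists_norm_iteratedDeriv_le_integral_top (E := E) hs hαβ hαβs hlength hj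
  refine ⟨∑ j ∈ Finset.range n, K j,
    Finset.sum_nonneg fun j hj => hK_nonneg j (Finset.mem_range.1 hj), fun u hu x hx => ?_⟩
  refine (Finset.sum_le_sum fun j hj => hK j (Finset.mem_range.1 hj) u hu x hx).trans_eq ?_
  simp [Finset.sum_add_distrib, Finset.sum_mul]

theorem IsElliptic.continuousOn_diffOp (hP : IsElliptic n a) {s : Set ℝ} (hs : IsOpen s)
    (hs_pos : s ⊆ Ioi 0) {u : ℝ → ℂ} (hu : ContDiffOn ℝ n u s) :
    ContinuousOn (diffOp n a u) s :=
  continuousOn_finsetSum _ fun i hi =>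
    ((hP.continuousOn_coeff i (Finset.mem_range_succ_iff.1 hi)).mono hs_pos).mul
      (continuousOn_iteratedDeriv hs hu (Finset.mem_range_succ_iff.1 hi))

theorem IsElliptic.intervalIntegrable_diffOp (hP : IsElliptic n a) (hpos : uIcc α β ⊆ Ioi 0)
    {u : ℝ → ℂ} (hu : ContDiffOn ℝ n u (Ioi 0)) :
    IntervalIntegrable (diffOp n a u) volume α β :=
  ((hP.continuousOn_diffOp isOpen_Ioi subset_rfl hu).mono hpos).intervalIntegrable

/-- `HasLeadingBound n a Q s` says that on `s` the equation `∑_{i ≤ n} a_i v_i = p` can be solved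
for the top entry of the jet `v`, with control by `p` and by the lower entries. -/
def HasLeadingBound (n : ℕ) (a : ℕ → ℝ → ℂ) (Q : ℝ) (s : Set ℝ) : Prop :=
  0 ≤ Q ∧ ∀ x ∈ s, ∀ v : ℕ → ℂ,
    ‖v n‖ ≤ Q * (‖∑ i ∈ Finset.range (n + 1), a i x * v i‖ + ∑ j ∈ Finset.range n, ‖v j‖)

theorem norm_le_of_sum_range_succ_mul {b : ℕ → ℂ} (hb : b n ≠ 0) (v : ℕ → ℂ) :
    ‖v n‖ ≤ ‖(b n)⁻¹‖ * (1 + ∑ j ∈ Finset.range n, ‖b j‖) *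
      (‖∑ i ∈ Finset.range (n + 1), b i * v i‖ + ∑ j ∈ Finset.range n, ‖v j‖) := by
  have solve : v n = (b n)⁻¹ * (∑ i ∈ Finset.range (n + 1), b i * v i -
      ∑ j ∈ Finset.range n, b j * v j) := by
    rw [Finset.sum_range_succ, add_sub_cancel_left, inv_mul_cancel_left₀ hb]
  have lower : ‖∑ j ∈ Finset.range n, b j * v j‖ ≤
      (∑ j ∈ Finset.range n, ‖b j‖) * ∑ j ∈ Finset.range n, ‖v j‖ := by
    rw [Finset.mul_sum]
    refine norm_sum_le_of_le _ fun j hj => (norm_mul _ _).trans_le ?_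
    gcongr
    exact Finset.single_le_sum (f := fun j => ‖b j‖) (fun _ _ => norm_nonneg _) hj
  have hb_nonneg : 0 ≤ ∑ j ∈ Finset.range n, ‖b j‖ := Finset.sum_nonneg fun _ _ => norm_nonneg _
  have hv_nonneg : 0 ≤ ∑ j ∈ Finset.range n, ‖v j‖ := Finset.sum_nonneg fun _ _ => norm_nonneg _
  rw [solve, norm_mul, mul_assoc]
  gcongr
  refine (norm_sub_le _ _).trans ?_
  nlinarith [norm_nonneg (∑ i ∈ Finset.range (n + 1), b i * v i)]

theorem IsElliptic.exists_hasLeadingBound (hP : IsElliptic n a) {s : Set ℝ} (hs : IsCompact s)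
    (hs_pos : s ⊆ Ioi 0) : ∃ Q, HasLeadingBound n a Q s := by
  have hcont : ContinuousOn (fun x => ‖(a n x)⁻¹‖ * (1 + ∑ j ∈ Finset.range n, ‖a j x‖)) s :=
    ((((hP.continuousOn_coeff n le_rfl).mono hs_pos).inv₀
      fun x hx => hP.leading_ne_zero x (hs_pos hx)).norm).mul
      (continuousOn_const.add (continuousOn_finsetSum _ fun j hj =>
        ((hP.continuousOn_coeff j (Finset.mem_range.1 hj).le).mono hs_pos).norm))
  obtain ⟨Q, hQ⟩ := hs.exists_bound_of_continuousOn hcont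
  refine ⟨max Q 0, le_max_right _ _, fun x hx v =>
    (norm_le_of_sum_range_succ_mul (b := fun i => a i x)
      (hP.leading_ne_zero x (hs_pos hx)) v).trans ?_⟩
  gcongr
  exact (le_abs_self _).trans ((hQ x hx).trans (le_max_left _ _))

/-- The interior estimate for the operator with coefficients `a` on `[c, d]`: on every subinterval,
the derivatives of order `< n` of a function `u` are controlled uniformly by the `L¹` norms of `u`
and of its image. Only the constant in front of `u` may depend on the subinterval. -/
def HasInteriorEstimate (n : ℕ) (a : ℕ → ℝ → ℂ) (C c d : ℝ) : Prop :=
  0 ≤ C ∧ ∀ ⦃α β : ℝ⦄, α < β → Icc α β ⊆ Icc c d → ∃ K ≥ 0, ∀ u : ℝ → ℂ,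
    ContDiffOn ℝ n u (Ioi 0) → ∀ x ∈ Icc α β,
      ∑ j ∈ Finset.range n, ‖iteratedDeriv j u x‖ ≤
        K * (∫ y in α..β, ‖u y‖) + C * ∫ y in α..β, ‖diffOp n a u y‖

theorem HasInteriorEstimate.mono {c' d' : ℝ} (hC : HasInteriorEstimate n a C c d) (hc : c ≤ c')
    (hd : d' ≤ d) : HasInteriorEstimate n a C c' d' :=
  ⟨hC.1, fun _ _ hαβ hsub => hC.2 hαβ (hsub.trans (Icc_subset_Icc hc hd))⟩

theorem HasLeadingBound.integral_norm_iteratedDeriv_le (hQ : HasLeadingBound n a Q (Icc α β))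
    (hP : IsElliptic n a) (hpos : Icc α β ⊆ Ioi 0) (hαβ : α ≤ β) {u : ℝ → ℂ}
    (hu : ContDiffOn ℝ n u (Ioi 0)) {M : ℝ}
    (hM : ∀ x ∈ Icc α β, ∑ j ∈ Finset.range n, ‖iteratedDeriv j u x‖ ≤ M) :
    ∫ y in α..β, ‖iteratedDeriv n u y‖ ≤
      Q * ((∫ y in α..β, ‖diffOp n a u y‖) + (β - α) * M) := by
  have huIcc : uIcc α β ⊆ Ioi 0 := by rwa [uIcc_of_le hαβ]
  have hPu := (hP.intervalIntegrable_diffOp huIcc hu).norm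
  calc ∫ y in α..β, ‖iteratedDeriv n u y‖ ≤ ∫ y in α..β, Q * (‖diffOp n a u y‖ + M) := by
        refine intervalIntegral.integral_mono_on hαβ
          (intervalIntegrable_iteratedDeriv isOpen_Ioi hu le_rfl huIcc).norm
          ((hPu.add intervalIntegrable_const).const_mul Q) fun x hx =>
            (hQ.2 x hx fun j => iteratedDeriv j u x).trans ?_
        exact mul_le_mul_of_nonneg_left (add_le_add_right (hM x hx) _) hQ.1
    _ = Q * ((∫ y in α..β, ‖diffOp n a u y‖) + (β - α) * M) := by
        rw [intervalIntegral.integral_const_mul,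
          intervalIntegral.integral_add hPu intervalIntegrable_const,
          intervalIntegral.integral_const, smul_eq_mul]

theorem HasLeadingBound.hasInteriorEstimate (hQ : HasLeadingBound n a Q (Icc c d))
    (hP : IsElliptic n a) (hc : 0 < c) (hlength : d - c ≤ 1) (hsmall : n * Q * (d - c) ≤ 1 / 2) :
    HasInteriorEstimate n a (2 * (n * Q)) c d := by
  have hQ_nonneg := hQ.1
  refine ⟨by positivity, fun α β hαβ hsub => ?_⟩
  have hpos : Icc α β ⊆ Ioi 0 := fun x hx => hc.trans_le (hsub hx).1
  have hαβ_le : β - α ≤ d - c := by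
    linarith [(hsub ⟨le_rfl, hαβ.le⟩).1, (hsub ⟨hαβ.le, le_rfl⟩).2]
  obtain ⟨K, hK_nonneg, hK⟩ := exists_sum_norm_iteratedDeriv_le_integral_top (E := ℂ) (n := n)
    isOpen_Ioi hαβ hpos (hαβ_le.trans hlength)
  refine ⟨2 * K, by positivity, fun u hu x hx => (hK u hu x hx).trans ?_⟩
  have hu_nonneg : 0 ≤ ∫ y in α..β, ‖u y‖ :=
    intervalIntegral.integral_nonneg hαβ.le fun _ _ => norm_nonneg _
  have hun_nonneg : 0 ≤ ∫ y in α..β, ‖iteratedDeriv n u y‖ :=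
    intervalIntegral.integral_nonneg hαβ.le fun _ _ => norm_nonneg _
  set M := K * (∫ y in α..β, ‖u y‖) + n * ∫ y in α..β, ‖iteratedDeriv n u y‖
  have hM_nonneg : 0 ≤ M := by positivity
  have htop : ∫ y in α..β, ‖iteratedDeriv n u y‖ ≤
      Q * ((∫ y in α..β, ‖diffOp n a u y‖) + (β - α) * M) :=
    HasLeadingBound.integral_norm_iteratedDeriv_le
      ⟨hQ_nonneg, fun x hx => hQ.2 x (hsub hx)⟩ hP hpos hαβ.le hu (hK u hu)
  have habsorb : n * Q * (β - α) * M ≤ 1 / 2 * M := by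
    refine mul_le_mul_of_nonneg_right (le_trans ?_ hsmall) hM_nonneg
    gcongr
  nlinarith [mul_le_mul_of_nonneg_left htop n.cast_nonneg (α := ℝ)]

theorem IsElliptic.exists_hasInteriorEstimate (hP : IsElliptic n a) {x₀ : ℝ} (hx₀ : 0 < x₀) :
    ∃ r > 0, r < x₀ ∧ ∃ C, HasInteriorEstimate n a C (x₀ - r) (x₀ + r) := by
  obtain ⟨Q, hQ⟩ := hP.exists_hasLeadingBound (isCompact_Icc (a := x₀ / 2) (b := 3 * x₀ / 2))
    fun x hx => (half_pos hx₀).trans_le hx.1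
  have hnQ : 0 ≤ n * Q := mul_nonneg n.cast_nonneg hQ.1
  set r := min (x₀ / 2) (1 / (4 * (n * Q + 1)))
  have hr : 0 < r := by positivity
  have hr_x₀ : r ≤ x₀ / 2 := min_le_left _ _
  have hr_small : r * (4 * (n * Q + 1)) ≤ 1 :=
    (le_div_iff₀ (by positivity)).1 (min_le_right _ _)
  refine ⟨r, hr, by linarith, _, HasLeadingBound.hasInteriorEstimate (Q := Q)
    ⟨hQ.1, fun x hx => hQ.2 x ⟨by linarith [hx.1], by linarith [hx.2]⟩⟩ hP (by linarith) ?_ ?_⟩ <;>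
  nlinarith

end Elliptic

/-! ### Closedness of elliptic operators in `L¹` -/

section Closedness

variable {n : ℕ} {a : ℕ → ℝ → ℂ} {c d x y : ℝ} {C Q : ℝ} {ι : Type*} {l : Filter ι}
  {W : ι → ℝ → ℂ} {g : ℝ → ℂ}

theorem integral_norm_le_integral_norm_add_of_Icc_subset {F G : ℝ → ℂ} (hxy : x ≤ y)
    (hsub : Icc x y ⊆ Icc c d) (hF : IntervalIntegrable F volume c d)
    (hG : IntervalIntegrable G volume c d) :
    ∫ t in x..y, ‖F t‖ ≤ (∫ t in x..y, ‖G t‖) + ∫ t in c..d, ‖F t - G t‖ := by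
  have hcd : c ≤ d := (hsub ⟨le_rfl, hxy⟩).1.trans (hsub ⟨le_rfl, hxy⟩).2
  have huIcc : uIcc x y ⊆ uIcc c d := by rwa [uIcc_of_le hxy, uIcc_of_le hcd]
  have hFxy := hF.mono_set huIcc
  have hGxy := hG.mono_set huIcc
  calc ∫ t in x..y, ‖F t‖ ≤ ∫ t in x..y, (‖G t‖ + ‖F t - G t‖) :=
        intervalIntegral.integral_mono_on hxy hFxy.norm (hGxy.norm.add (hFxy.sub hGxy).norm)
          fun t _ => by simpa using norm_add_le (G t) (F t - G t)
    _ = (∫ t in x..y, ‖G t‖) + ∫ t in x..y, ‖F t - G t‖ :=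
        intervalIntegral.integral_add hGxy.norm (hFxy.sub hGxy).norm
    _ ≤ (∫ t in x..y, ‖G t‖) + ∫ t in c..d, ‖F t - G t‖ := by
        gcongr
        exact intervalIntegral.integral_mono_interval (hsub ⟨le_rfl, hxy⟩).1 hxy
          (hsub ⟨hxy, le_rfl⟩).2 (.of_forall fun _ => norm_nonneg _) (hF.sub hG).norm

/-- The hypotheses of closedness in `L¹(c, d)`: `W_i → 0` and `P W_i → g` in `L¹(c, d)`, where the
`W_i` are of class `C^n` on `(0, ∞)` and `P` has coefficients `a`. -/
structure TendstoGraph (n : ℕ) (a : ℕ → ℝ → ℂ) (c d : ℝ) (W : ι → ℝ → ℂ) (l : Filter ι)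
    (g : ℝ → ℂ) : Prop where
  contDiffOn : ∀ i, ContDiffOn ℝ n (W i) (Ioi 0)
  intervalIntegrable : IntervalIntegrable g volume c d
  tendsto_zero : Tendsto (fun i => ∫ t in c..d, ‖W i t‖) l (𝓝 0)
  tendsto_diffOp : Tendsto (fun i => ∫ t in c..d, ‖diffOp n a (W i) t - g t‖) l (𝓝 0)

theorem TendstoGraph.eventually_sum_norm_iteratedDeriv_le (hW : TendstoGraph n a c d W l g)
    (hP : IsElliptic n a) (hc : 0 < c) (hC : HasInteriorEstimate n a C c d) (hxy : x < y)
    (hsub : Icc x y ⊆ Icc c d) {ε : ℝ} (hε : 0 < ε) :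
    ∀ᶠ i in l, ∀ t ∈ Icc x y, ∑ j ∈ Finset.range n, ‖iteratedDeriv j (W i) t‖ ≤
      C * (∫ t in x..y, ‖g t‖) + ε := by
  obtain ⟨hC_nonneg, hestimate⟩ := hC
  obtain ⟨K, hK_nonneg, hK⟩ := hestimate hxy hsub
  have hcx : c ≤ x := (hsub ⟨le_rfl, hxy.le⟩).1
  have hyd : y ≤ d := (hsub ⟨hxy.le, le_rfl⟩).2
  have hcd : c ≤ d := hcx.trans (hxy.le.trans hyd)
  have huIcc : uIcc c d ⊆ Ioi 0 := by
    rw [uIcc_of_le hcd]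
    exact fun t ht => hc.trans_le ht.1
  have hlim : Tendsto (fun i => K * (∫ t in c..d, ‖W i t‖) +
      C * ∫ t in c..d, ‖diffOp n a (W i) t - g t‖) l (𝓝 0) := by
    simpa using (hW.tendsto_zero.const_mul K).add (hW.tendsto_diffOp.const_mul C)
  filter_upwards [hlim.eventually_le_const hε] with i hi t ht
  have hWi : ∫ t in x..y, ‖W i t‖ ≤ ∫ t in c..d, ‖W i t‖ :=
    intervalIntegral.integral_mono_interval hcx hxy.le hyd (.of_forall fun _ => norm_nonneg _)
      ((hW.contDiffOn i).continuousOn.mono huIcc).intervalIntegrable.norm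
  have hPW := integral_norm_le_integral_norm_add_of_Icc_subset hxy.le hsub
    (hP.intervalIntegrable_diffOp huIcc (hW.contDiffOn i)) hW.intervalIntegrable
  linarith [hK (W i) (hW.contDiffOn i) t ht, mul_le_mul_of_nonneg_left hWi hK_nonneg,
    mul_le_mul_of_nonneg_left hPW hC_nonneg]

theorem TendstoGraph.tendsto_sum_norm_iteratedDeriv (hW : TendstoGraph n a c d W l g)
    (hP : IsElliptic n a) (hc : 0 < c) (hC : HasInteriorEstimate n a C c d) (hx : x ∈ Ico c d) :
    Tendsto (fun i => ∑ j ∈ Finset.range n, ‖iteratedDeriv j (W i) x‖) l (𝓝 0) := by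
  have hcd : c ≤ d := hx.1.trans hx.2.le
  have hprim : Tendsto (fun y => C * ∫ t in x..y, ‖g t‖) (𝓝[>] x) (𝓝 0) := by
    have hcont : ContinuousOn (fun y => ∫ t in x..y, ‖g t‖) (Icc x d) := by
      rw [← uIcc_of_le hx.2.le]
      refine intervalIntegral.continuousOn_primitive_interval' (hW.intervalIntegrable.norm.mono_set
        ?_) left_mem_uIcc
      rw [uIcc_of_le hx.2.le, uIcc_of_le hcd]
      exact Icc_subset_Icc_left hx.1
    have := (hcont x ⟨le_rfl, hx.2.le⟩).tendsto.mono_left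
      (nhdsWithin_le_of_mem (Icc_mem_nhdsGT_of_mem ⟨le_rfl, hx.2⟩))
    simpa using this.const_mul C
  refine Metric.tendsto_nhds.2 fun ε hε => ?_
  obtain ⟨y, hy, hxy, hyd⟩ := ((hprim.eventually_lt_const (half_pos hε)).and
    (Ioo_mem_nhdsGT hx.2)).exists
  filter_upwards [hW.eventually_sum_norm_iteratedDeriv_le hP hc hC hxy
    (Icc_subset_Icc hx.1 hyd.le) (half_pos hε)] with i hi
  rw [Real.dist_0_eq_abs, abs_of_nonneg (Finset.sum_nonneg fun _ _ => norm_nonneg _)]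
  linarith [hi x ⟨le_rfl, hxy.le⟩]

theorem intervalIntegrable_sum_norm_iteratedDeriv {u : ℝ → ℂ} (hu : ContDiffOn ℝ n u (Ioi 0))
    (hpos : uIcc x y ⊆ Ioi 0) :
    IntervalIntegrable (fun t => ∑ j ∈ Finset.range n, ‖iteratedDeriv j u t‖) volume x y :=
  (continuousOn_finsetSum _ fun _ hj => ((continuousOn_iteratedDeriv isOpen_Ioi hu
    (Finset.mem_range.1 hj).le).mono hpos).norm).intervalIntegrable

theorem TendstoGraph.tendsto_integral_sum_norm_iteratedDeriv [l.IsCountablyGenerated]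
    (hW : TendstoGraph n a c d W l g) (hP : IsElliptic n a) (hc : 0 < c)
    (hC : HasInteriorEstimate n a C c d) (hcx : c ≤ x) (hxy : x < y) (hyd : y < d) :
    Tendsto (fun i => ∫ t in x..y, ∑ j ∈ Finset.range n, ‖iteratedDeriv j (W i) t‖) l (𝓝 0) := by
  have hsub : Icc x y ⊆ Icc c d := Icc_subset_Icc hcx hyd.le
  have hpos : uIcc x y ⊆ Ioi 0 := by
    rw [uIcc_of_le hxy.le]
    exact fun t ht => hc.trans_le (hcx.trans ht.1)
  have hbound := hW.eventually_sum_norm_iteratedDeriv_le hP hc hC hxy hsub one_pos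
  rw [← intervalIntegral.integral_zero (a := x) (b := y) (μ := volume)]
  refine intervalIntegral.tendsto_integral_filter_of_dominated_convergence
    (fun _ => C * (∫ t in x..y, ‖g t‖) + 1) (.of_forall fun i => ?_) ?_
    intervalIntegrable_const (.of_forall fun t ht => ?_)
  · exact (intervalIntegrable_iff.1 (intervalIntegrable_sum_norm_iteratedDeriv
      (hW.contDiffOn i) hpos)).aestronglyMeasurable
  · filter_upwards [hbound] with i hi
    refine .of_forall fun t ht => ?_
    rw [uIoc_of_le hxy.le] at ht
    rw [Real.norm_of_nonneg (Finset.sum_nonneg fun _ _ => norm_nonneg _)]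
    exact hi t (Ioc_subset_Icc_self ht)
  · rw [uIoc_of_le hxy.le] at ht
    exact hW.tendsto_sum_norm_iteratedDeriv hP hc hC
      ⟨hcx.trans ht.1.le, ht.2.trans_lt hyd⟩

theorem HasLeadingBound.norm_iteratedDeriv_sub_div_le {s : Set ℝ} (hQ : HasLeadingBound n a Q s)
    (hx : x ∈ s) (hax : a n x ≠ 0) (u : ℝ → ℂ) (z : ℂ) :
    ‖iteratedDeriv n u x - z / a n x‖ ≤
      Q * (‖diffOp n a u x - z‖ + ∑ j ∈ Finset.range n, ‖iteratedDeriv j u x‖) := by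
  let v := Function.update (fun j => iteratedDeriv j u x) n (iteratedDeriv n u x - z / a n x)
  have hv_lt {j : ℕ} (hj : j ∈ Finset.range n) : v j = iteratedDeriv j u x :=
    Function.update_of_ne (Finset.mem_range.1 hj).ne _ _
  have hv_top : v n = iteratedDeriv n u x - z / a n x := Function.update_self ..
  have hsum : ∑ i ∈ Finset.range (n + 1), a i x * v i = diffOp n a u x - z := by
    rw [diffOp, Finset.sum_range_succ, Finset.sum_range_succ, hv_top,
      Finset.sum_congr rfl fun j hj => by rw [hv_lt hj], mul_sub, mul_div_cancel₀ _ hax]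
    ring
  have := hQ.2 x hx v
  rwa [hsum, hv_top, Finset.sum_congr rfl fun j hj => by rw [hv_lt hj]] at this

theorem TendstoGraph.tendsto_integral_iteratedDeriv (hW : TendstoGraph n a c d W l g)
    (hP : IsElliptic n a) (hc : 0 < c) (hC : HasInteriorEstimate n a C c d) (hcx : c ≤ x)
    (hxy : x < y) (hyd : y < d) :
    Tendsto (fun i => ∫ t in x..y, iteratedDeriv n (W i) t) l (𝓝 0) := by
  obtain ⟨m, rfl⟩ : ∃ m, n = m + 1 := ⟨n - 1, by have := hP.order_pos; omega⟩
  have hpos : uIcc x y ⊆ Ioi 0 := by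
    rw [uIcc_of_le hxy.le]
    exact fun t ht => hc.trans_le (hcx.trans ht.1)
  have hlim {t : ℝ} (ht : t ∈ Ico c d) :
      Tendsto (fun i => iteratedDeriv m (W i) t) l (𝓝 0) :=
    squeeze_zero_norm (fun i => Finset.single_le_sum (f := fun j => ‖iteratedDeriv j (W i) t‖)
      (fun _ _ => norm_nonneg _) (Finset.self_mem_range_succ m))
      (hW.tendsto_sum_norm_iteratedDeriv hP hc hC ht)
  rw [← sub_zero (0 : ℂ)]
  refine ((hlim ⟨hcx.trans hxy.le, hyd⟩).sub (hlim ⟨hcx, hxy.trans hyd⟩)).congr fun i => ?_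
  exact (intervalIntegral.integral_eq_sub_of_hasDerivAt
    (fun t ht => hasDerivAt_iteratedDeriv isOpen_Ioi (hW.contDiffOn i) m.lt_succ_self (hpos ht))
    (intervalIntegrable_iteratedDeriv isOpen_Ioi (hW.contDiffOn i) le_rfl hpos)).symm

theorem TendstoGraph.intervalIntegrable_div_leading (hW : TendstoGraph n a c d W l g)
    (hP : IsElliptic n a) (hc : 0 < c) (hcd : c ≤ d) :
    IntervalIntegrable (fun t => g t / a n t) volume c d := by
  have hpos : uIcc c d ⊆ Ioi 0 := by
    rw [uIcc_of_le hcd]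
    exact fun t ht => hc.trans_le ht.1
  simp only [div_eq_mul_inv]
  exact hW.intervalIntegrable.mul_continuousOn (((hP.continuousOn_coeff n le_rfl).mono hpos).inv₀
    fun t ht => hP.leading_ne_zero t (hpos ht))

theorem TendstoGraph.tendsto_integral_iteratedDeriv_sub_div [l.IsCountablyGenerated]
    (hW : TendstoGraph n a c d W l g) (hP : IsElliptic n a) (hc : 0 < c)
    (hC : HasInteriorEstimate n a C c d) (hcx : c ≤ x) (hxy : x < y) (hyd : y < d) :
    Tendsto (fun i => ∫ t in x..y, (iteratedDeriv n (W i) t - g t / a n t)) l (𝓝 0) := by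
  have hcd : c ≤ d := hcx.trans (hxy.le.trans hyd.le)
  have hpos : Icc c d ⊆ Ioi 0 := fun t ht => hc.trans_le ht.1
  have hsub : uIcc x y ⊆ uIcc c d := by
    rw [uIcc_of_le hxy.le, uIcc_of_le hcd]
    exact Icc_subset_Icc hcx hyd.le
  have hpos' : uIcc c d ⊆ Ioi 0 := by rwa [uIcc_of_le hcd]
  obtain ⟨Q, hQ⟩ := hP.exists_hasLeadingBound isCompact_Icc hpos
  have hbound := ((hW.tendsto_diffOp.add
    (hW.tendsto_integral_sum_norm_iteratedDeriv hP hc hC hcx hxy hyd)).const_mul Q)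
  rw [add_zero, mul_zero] at hbound
  refine squeeze_zero_norm (fun i => ?_) hbound
  have hPW : IntervalIntegrable (fun t => ‖diffOp n a (W i) t - g t‖) volume c d :=
    ((hP.intervalIntegrable_diffOp hpos' (hW.contDiffOn i)).sub hW.intervalIntegrable).norm
  have hS := intervalIntegrable_sum_norm_iteratedDeriv (hW.contDiffOn i) (hsub.trans hpos')
  calc ‖∫ t in x..y, (iteratedDeriv n (W i) t - g t / a n t)‖
      ≤ ∫ t in x..y, Q * (‖diffOp n a (W i) t - g t‖ +
          ∑ j ∈ Finset.range n, ‖iteratedDeriv j (W i) t‖) :=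
        intervalIntegral.norm_integral_le_of_norm_le hxy.le (.of_forall fun t ht =>
          have htcd : t ∈ Icc c d := ⟨hcx.trans ht.1.le, ht.2.trans hyd.le⟩
          hQ.norm_iteratedDeriv_sub_div_le htcd (hP.leading_ne_zero t (hpos htcd)) (W i) (g t))
          (((hPW.mono_set hsub).add hS).const_mul Q)
    _ = Q * ((∫ t in x..y, ‖diffOp n a (W i) t - g t‖) +
          ∫ t in x..y, ∑ j ∈ Finset.range n, ‖iteratedDeriv j (W i) t‖) := by
        rw [intervalIntegral.integral_const_mul, intervalIntegral.integral_add
          (hPW.mono_set hsub) hS]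
    _ ≤ Q * ((∫ t in c..d, ‖diffOp n a (W i) t - g t‖) +
          ∫ t in x..y, ∑ j ∈ Finset.range n, ‖iteratedDeriv j (W i) t‖) := by
        refine mul_le_mul_of_nonneg_left (add_le_add_left ?_ _) hQ.1
        exact intervalIntegral.integral_mono_interval hcx hxy.le hyd.le
          (.of_forall fun _ => norm_nonneg _) hPW

theorem TendstoGraph.integral_div_leading_eq_zero [l.NeBot] [l.IsCountablyGenerated]
    (hW : TendstoGraph n a c d W l g) (hP : IsElliptic n a) (hc : 0 < c)
    (hC : HasInteriorEstimate n a C c d) (hcx : c ≤ x) (hxy : x < y) (hyd : y < d) :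
    ∫ t in x..y, g t / a n t = 0 := by
  have hcd : c ≤ d := hcx.trans (hxy.le.trans hyd.le)
  have hsub : uIcc x y ⊆ uIcc c d := by
    rw [uIcc_of_le hxy.le, uIcc_of_le hcd]
    exact Icc_subset_Icc hcx hyd.le
  have hpos : uIcc x y ⊆ Ioi 0 := by
    rw [uIcc_of_le hxy.le]
    exact fun t ht => hc.trans_le (hcx.trans ht.1)
  have hg := (hW.intervalIntegrable_div_leading hP hc hcd).mono_set hsub
  have hlim := (hW.tendsto_integral_iteratedDeriv hP hc hC hcx hxy hyd).sub
    (hW.tendsto_integral_iteratedDeriv_sub_div hP hc hC hcx hxy hyd)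
  rw [sub_zero] at hlim
  refine tendsto_nhds_unique (tendsto_const_nhds.congr fun i => ?_) hlim
  have hWn := intervalIntegrable_iteratedDeriv isOpen_Ioi (hW.contDiffOn i) le_rfl hpos
  rw [← intervalIntegral.integral_sub hWn (hWn.sub hg)]
  simp only [sub_sub_cancel]

theorem ae_eq_zero_of_forall_integral_eq_zero {E : Type*} [NormedAddCommGroup E] [NormedSpace ℝ E]
    [CompleteSpace E] {F : ℝ → E} (hF : IntervalIntegrable F volume c d)
    (hzero : ∀ x y, c < x → x < y → y < d → ∫ t in x..y, F t = 0) :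
    ∀ᵐ t, t ∈ Ioo c d → F t = 0 := by
  filter_upwards [hF.ae_hasDerivAt_integral] with x hx hxI
  have huIcc : Ioo c d ⊆ uIcc c d := Ioo_subset_Icc_self.trans Icc_subset_uIcc
  obtain ⟨z, hcz, hzx⟩ := exists_between hxI.1
  have hprim : HasDerivAt (fun y => ∫ t in z..y, F t) 0 x :=
    (hasDerivAt_const x (0 : E)).congr_of_eventuallyEq <| by
      filter_upwards [Ioo_mem_nhds hzx hxI.2] with y hy using hzero z y hcz hy.1 hy.2
  exact (hx (huIcc hxI) z (huIcc ⟨hcz, hzx.trans hxI.2⟩)).unique hprim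

theorem TendstoGraph.ae_eq_zero_of_hasInteriorEstimate [l.NeBot] [l.IsCountablyGenerated]
    (hW : TendstoGraph n a c d W l g) (hP : IsElliptic n a) (hc : 0 < c) (hcd : c ≤ d)
    (hC : HasInteriorEstimate n a C c d) : ∀ᵐ t, t ∈ Ioo c d → g t = 0 := by
  filter_upwards [ae_eq_zero_of_forall_integral_eq_zero
    (hW.intervalIntegrable_div_leading hP hc hcd) fun x y hcx hxy hyd =>
      hW.integral_div_leading_eq_zero hP hc hC hcx.le hxy hyd] with t ht htI
  exact (div_eq_zero_iff.1 (ht htI)).resolve_right (hP.leading_ne_zero t (hc.trans htI.1))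

theorem IsElliptic.ae_eq_zero_of_tendstoGraph [l.NeBot] [l.IsCountablyGenerated]
    (hP : IsElliptic n a) {Ω : Set ℝ} (hΩ : IsOpen Ω) (hΩ_pos : Ω ⊆ Ioi 0)
    (hW : ∀ c d, c ≤ d → Icc c d ⊆ Ω → TendstoGraph n a c d W l g) :
    ∀ᵐ t ∂volume.restrict Ω, g t = 0 := by
  rw [ae_restrict_iff' hΩ.measurableSet]
  have hnull : volume {t | t ∈ Ω ∧ g t ≠ 0} = 0 := by
    refine measure_null_of_locally_null _ fun x hx => ?_
    obtain ⟨r, hr, hrx, C, hC⟩ := hP.exists_hasInteriorEstimate (hΩ_pos hx.1)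
    obtain ⟨ρ, hρ, hball⟩ := Metric.nhds_basis_closedBall.mem_iff.1 (hΩ.mem_nhds hx.1)
    set s := min r ρ
    have hs : 0 < s := lt_min hr hρ
    have hsr : s ≤ r := min_le_left _ _
    have hsub : Icc (x - s) (x + s) ⊆ Ω := by
      rw [← Real.closedBall_eq_Icc]
      exact (Metric.closedBall_subset_closedBall (min_le_right _ _)).trans hball
    have hae := (hW _ _ (by linarith) hsub).ae_eq_zero_of_hasInteriorEstimate hP (by linarith)
      (by linarith) (hC.mono (by linarith) (by linarith))
    refine ⟨{t | t ∈ Ω ∧ g t ≠ 0} ∩ Ioo (x - s) (x + s),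
      inter_mem_nhdsWithin _ (Ioo_mem_nhds (by linarith) (by linarith)),
      measure_mono_null ?_ (ae_iff.1 hae)⟩
    exact fun t ⟨⟨_, ht⟩, htI⟩ himp => ht (himp htI)
  rw [ae_iff]
  simpa only [Classical.not_imp] using hnull

end Closedness

/-! ### Eigenfunctions -/

section Eigenfunctions

theorem eq_zero_of_norm_deriv_le_mul_norm {E : Type*} [NormedAddCommGroup E] [NormedSpace ℝ E]
    {y y' : ℝ → E} {c d K x₀ x : ℝ} (hy : ∀ t ∈ Icc c d, HasDerivAt y (y' t) t)
    (hK : ∀ t ∈ Icc c d, ‖y' t‖ ≤ K * ‖y t‖) (hx₀ : x₀ ∈ Icc c d) (hyx₀ : y x₀ = 0)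
    (hx : x ∈ Icc c d) : y x = 0 := by
  rcases le_total x₀ x with hle | hle
  · have hsub : Icc x₀ x ⊆ Icc c d := Icc_subset_Icc hx₀.1 hx.2
    exact eq_zero_of_abs_deriv_le_mul_abs_self_of_eq_zero_right
      (fun t ht => (hy t (hsub ht)).continuousAt.continuousWithinAt)
      (fun t ht => (hy t (hsub (Ico_subset_Icc_self ht))).hasDerivWithinAt) hyx₀
      (fun t ht => hK t (hsub (Ico_subset_Icc_self ht))) x ⟨hle, le_rfl⟩
  · have hneg {t : ℝ} (ht : t ∈ Icc (-x₀) (-x)) : -t ∈ Icc c d :=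
      ⟨by linarith [hx.1, ht.2], by linarith [hx₀.2, ht.1]⟩
    have hderiv (t : ℝ) (ht : t ∈ Icc (-x₀) (-x)) :
        HasDerivAt (fun t => y (-t)) (-y' (-t)) t := by
      simpa [Function.comp_def] using (hy (-t) (hneg ht)).scomp t (hasDerivAt_neg t)
    simpa using eq_zero_of_abs_deriv_le_mul_abs_self_of_eq_zero_right
      (fun t ht => (hderiv t ht).continuousAt.continuousWithinAt)
      (fun t ht => (hderiv t (Ico_subset_Icc_self ht)).hasDerivWithinAt) (by simpa using hyx₀)
      (fun t ht => (norm_neg _).trans_le (hK _ (hneg (Ico_subset_Icc_self ht)))) (-x)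
      ⟨neg_le_neg hle, le_rfl⟩

/-- `u` is a solution of class `C^n` on `(0, ∞)` of `P u = ev u`, where `P` is the differential
operator of order `n` with coefficients `a`; the zero function is allowed. -/
structure IsEigenfunction (n : ℕ) (a : ℕ → ℝ → ℂ) (ev : ℂ) (u : ℝ → ℂ) : Prop where
  contDiffOn : ContDiffOn ℝ n u (Ioi 0)
  diffOp_eq : ∀ r > 0, diffOp n a u r = ev * u r

/-- The vector `(u(x), u'(x), …, u^{(n-1)}(x))` of initial values at `x` for an equation of
order `n`. -/
noncomputable def cauchyData (n : ℕ) (u : ℝ → ℂ) (x : ℝ) : Fin n → ℂ := fun j => iteratedDeriv j u x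

variable {n : ℕ} {a : ℕ → ℝ → ℂ} {ev : ℂ} {u : ℝ → ℂ} {x x₀ : ℝ}

theorem norm_iteratedDeriv_le_norm_cauchyData {j : ℕ} (hj : j < n) :
    ‖iteratedDeriv j u x‖ ≤ ‖cauchyData n u x‖ :=
  norm_le_pi_norm (cauchyData n u x) ⟨j, hj⟩

theorem IsEigenfunction.norm_iteratedDeriv_succ_le (hu : IsEigenfunction n a ev u)
    (hn : 0 < n) {Q : ℝ} {s : Set ℝ} (hQ : HasLeadingBound n a Q s) (hs : s ⊆ Ioi 0) (hx : x ∈ s)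
    (j : Fin n) :
    ‖iteratedDeriv (j + 1) u x‖ ≤ max 1 (Q * (‖ev‖ + n)) * ‖cauchyData n u x‖ := by
  obtain hj | hj : (j : ℕ) + 1 < n ∨ (j : ℕ) + 1 = n := by omega
  · calc ‖iteratedDeriv (j + 1) u x‖ ≤ 1 * ‖cauchyData n u x‖ := by
          rw [one_mul]
          exact norm_iteratedDeriv_le_norm_cauchyData hj
      _ ≤ max 1 (Q * (‖ev‖ + n)) * ‖cauchyData n u x‖ := by
          gcongr
          exact le_max_left _ _
  · have hQ_nonneg := hQ.1
    calc ‖iteratedDeriv (j + 1) u x‖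
        ≤ Q * (‖diffOp n a u x‖ + ∑ j ∈ Finset.range n, ‖iteratedDeriv j u x‖) := by
          rw [hj]
          exact hQ.2 x hx fun j => iteratedDeriv j u x
      _ ≤ Q * (‖ev‖ * ‖cauchyData n u x‖ + ∑ _j ∈ Finset.range n, ‖cauchyData n u x‖) := by
          rw [hu.diffOp_eq x (hs hx), norm_mul]
          gcongr with j hj
          · exact iteratedDeriv_zero (f := u) ▸ norm_iteratedDeriv_le_norm_cauchyData hn
          · exact norm_iteratedDeriv_le_norm_cauchyData (Finset.mem_range.1 hj)
      _ = Q * (‖ev‖ + n) * ‖cauchyData n u x‖ := by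
          rw [Finset.sum_const, Finset.card_range, nsmul_eq_mul]
          ring
      _ ≤ max 1 (Q * (‖ev‖ + n)) * ‖cauchyData n u x‖ := by
          gcongr
          exact le_max_right _ _

theorem IsEigenfunction.eq_zero_of_cauchyData_eq_zero (hu : IsEigenfunction n a ev u)
    (hP : IsElliptic n a) (hx₀ : 0 < x₀) (hdata : cauchyData n u x₀ = 0) (hx : 0 < x) :
    u x = 0 := by
  set s := Icc (min x x₀) (max x x₀)
  have hs : s ⊆ Ioi 0 := fun t ht => (lt_min hx hx₀).trans_le ht.1
  obtain ⟨Q, hQ⟩ := hP.exists_hasLeadingBound isCompact_Icc hs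
  have hderiv (t : ℝ) (ht : t ∈ s) :
      HasDerivAt (cauchyData n u) (fun j : Fin n => iteratedDeriv (j + 1) u t) t :=
    hasDerivAt_pi.2 fun j => hasDerivAt_iteratedDeriv isOpen_Ioi hu.contDiffOn j.2 (hs ht)
  have hdata_x : cauchyData n u x = 0 :=
    eq_zero_of_norm_deriv_le_mul_norm hderiv
      (fun t ht => (pi_norm_le_iff_of_nonneg (by positivity)).2
        (hu.norm_iteratedDeriv_succ_le hP.order_pos hQ hs ht))
      ⟨min_le_right _ _, le_max_right _ _⟩ hdata ⟨min_le_left _ _, le_max_left _ _⟩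
  simpa [cauchyData] using congrFun hdata_x ⟨0, hP.order_pos⟩

theorem iteratedDeriv_sum_mul {ι : Type*} {ψ : ι → ℝ → ℂ} {s : Finset ι} (c : ι → ℂ)
    (hψ : ∀ k ∈ s, ContDiffOn ℝ n (ψ k) (Ioi 0)) {i : ℕ} (hi : i ≤ n) (hx : 0 < x) :
    iteratedDeriv i (fun r => ∑ k ∈ s, c k * ψ k r) x =
      ∑ k ∈ s, c k * iteratedDeriv i (ψ k) x := by
  have hsmooth (k) (hk : k ∈ s) : ContDiffAt ℝ i (fun r => c k * ψ k r) x :=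
    contDiffAt_const.mul (((hψ k hk).contDiffAt (Ioi_mem_nhds hx)).of_le (mod_cast hi))
  rw [iteratedDeriv_fun_sum hsmooth]
  exact Finset.sum_congr rfl fun k _ => iteratedDeriv_const_mul_field (c k) (ψ k)

theorem cauchyData_sum_mul {ι : Type*} {ψ : ι → ℝ → ℂ} {s : Finset ι} (c : ι → ℂ)
    (hψ : ∀ k ∈ s, ContDiffOn ℝ n (ψ k) (Ioi 0)) (hx : 0 < x) :
    cauchyData n (fun r => ∑ k ∈ s, c k * ψ k r) x = ∑ k ∈ s, c k • cauchyData n (ψ k) x := by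
  ext j
  simp only [cauchyData, iteratedDeriv_sum_mul c hψ j.2.le hx, Finset.sum_apply, Pi.smul_apply,
    smul_eq_mul]

theorem diffOp_sum_mul {ι : Type*} {ψ : ι → ℝ → ℂ} {s : Finset ι} (c : ι → ℂ)
    (hψ : ∀ k ∈ s, ContDiffOn ℝ n (ψ k) (Ioi 0)) (hx : 0 < x) :
    diffOp n a (fun r => ∑ k ∈ s, c k * ψ k r) x = ∑ k ∈ s, c k * diffOp n a (ψ k) x := by
  simp only [diffOp, Finset.mul_sum]
  rw [Finset.sum_comm]
  refine Finset.sum_congr rfl fun i hi => ?_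
  rw [iteratedDeriv_sum_mul c hψ (Finset.mem_range_succ_iff.1 hi) hx, Finset.mul_sum]
  exact Finset.sum_congr rfl fun k _ => mul_left_comm _ _ _

theorem IsEigenfunction.sum_mul {ι : Type*} {ψ : ι → ℝ → ℂ} {s : Finset ι} (c : ι → ℂ)
    (hψ : ∀ k ∈ s, IsEigenfunction n a ev (ψ k)) :
    IsEigenfunction n a ev fun r => ∑ k ∈ s, c k * ψ k r where
  contDiffOn := ContDiffOn.sum fun k hk => contDiffOn_const.mul (hψ k hk).contDiffOn
  diffOp_eq r hr := by
    rw [diffOp_sum_mul c (fun k hk => (hψ k hk).contDiffOn) hr, Finset.mul_sum]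
    refine Finset.sum_congr rfl fun k hk => ?_
    rw [(hψ k hk).diffOp_eq r hr]
    ring

theorem IsEigenfunction.eq_zero_of_eqOn_isOpen (hu : IsEigenfunction n a ev u)
    (hP : IsElliptic n a) {Ω : Set ℝ} (hΩ : IsOpen Ω) (hΩ_pos : Ω ⊆ Ioi 0) (hΩ_ne : Ω.Nonempty)
    (hzero : ∀ r ∈ Ω, u r = 0) (hx : 0 < x) : u x = 0 := by
  obtain ⟨x₀, hx₀⟩ := hΩ_ne
  refine hu.eq_zero_of_cauchyData_eq_zero hP (hΩ_pos hx₀) (funext fun j => ?_) hx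
  have hloc : u =ᶠ[𝓝 x₀] fun _ => 0 := eventually_of_mem (hΩ.mem_nhds hx₀) hzero
  simp [cauchyData, hloc.iteratedDeriv_eq]

end Eigenfunctions

/-! ### Weighted `L²` spaces -/

section Weight

open scoped ENNReal

/-- `w` is an admissible weight on `(0, ∞)`: measurable, positive, and with locally integrable
inverse, so that `L²(w dr)` embeds into `L¹` of every compact interval of `(0, ∞)`. -/
structure IsWeight (w : ℝ → ℝ) : Prop where
  aemeasurable : AEMeasurable w (volume.restrict (Ioi 0))
  pos : ∀ r > 0, 0 < w r
  locallyIntegrableOn_inv : LocallyIntegrableOn (fun r => (w r)⁻¹) (Ioi 0) volume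

theorem lintegral_enorm_le_rpow_lintegral_inv_mul_eLpNorm {α E : Type*} [MeasurableSpace α]
    [NormedAddCommGroup E] {ν : Measure α} {ρ : α → ℝ≥0∞} (hρ : AEMeasurable ρ ν)
    (hρ_ne_zero : ∀ᵐ x ∂ν, ρ x ≠ 0) (hρ_ne_top : ∀ᵐ x ∂ν, ρ x ≠ ∞) {h : α → E}
    (hh : AEStronglyMeasurable h ν) :
    ∫⁻ x, ‖h x‖ₑ ∂ν ≤
      (∫⁻ x, (ρ x)⁻¹ ∂ν) ^ (1 / 2 : ℝ) * eLpNorm h 2 (ν.withDensity ρ) := by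
  have hsqrt (y : ℝ≥0∞) : (y ^ (1 / 2 : ℝ)) ^ (2 : ℝ) = y := by
    rw [← ENNReal.rpow_mul]
    norm_num
  calc ∫⁻ x, ‖h x‖ₑ ∂ν
      = ∫⁻ x, ((fun x => (ρ x)⁻¹ ^ (1 / 2 : ℝ)) * fun x => ρ x ^ (1 / 2 : ℝ) * ‖h x‖ₑ) x ∂ν := by
        refine lintegral_congr_ae ?_
        filter_upwards [hρ_ne_zero, hρ_ne_top] with x hx_zero hx_top
        rw [Pi.mul_apply, ← mul_assoc, ← ENNReal.mul_rpow_of_nonneg _ _ (by norm_num),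
          ENNReal.inv_mul_cancel hx_zero hx_top, ENNReal.one_rpow, one_mul]
    _ ≤ (∫⁻ x, ((ρ x)⁻¹ ^ (1 / 2 : ℝ)) ^ (2 : ℝ) ∂ν) ^ (1 / 2 : ℝ) *
          (∫⁻ x, (ρ x ^ (1 / 2 : ℝ) * ‖h x‖ₑ) ^ (2 : ℝ) ∂ν) ^ (1 / 2 : ℝ) :=
        ENNReal.lintegral_mul_le_Lp_mul_Lq ν Real.HolderConjugate.two_two
          (hρ.inv.pow_const _) ((hρ.pow_const _).mul hh.enorm)
    _ = (∫⁻ x, (ρ x)⁻¹ ∂ν) ^ (1 / 2 : ℝ) * eLpNorm h 2 (ν.withDensity ρ) := by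
        rw [eLpNorm_eq_lintegral_rpow_enorm_toReal two_ne_zero ENNReal.ofNat_ne_top,
          ENNReal.toReal_ofNat,
          lintegral_withDensity_eq_lintegral_mul_non_measurable₀ ν hρ
            (hρ_ne_top.mono fun x hx => hx.lt_top)]
        simp only [hsqrt, ENNReal.mul_rpow_of_nonneg _ _ zero_le_two, Pi.mul_apply]

variable {w : ℝ → ℝ} {c d : ℝ}

theorem IsWeight.ae_weightMeasure_iff (hw : IsWeight w) {p : ℝ → Prop} :
    (∀ᵐ r ∂weightMeasure w, p r) ↔ ∀ᵐ r ∂volume.restrict (Ioi 0), p r := by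
  have hpos : ∀ᵐ r ∂volume.restrict (Ioi 0), ENNReal.ofReal (w r) ≠ 0 := by
    filter_upwards [ae_restrict_mem measurableSet_Ioi] with r hr
    simpa using hw.pos r hr
  exact ⟨fun h => (withDensity_absolutelyContinuous' hw.aemeasurable.ennreal_ofReal hpos) h,
    fun h => withDensity_absolutelyContinuous _ _ h⟩

theorem IsWeight.exists_lintegral_enorm_le (hw : IsWeight w) (hcd : Icc c d ⊆ Ioi 0) :
    ∃ K ≠ ∞, ∀ h : ℝ → ℂ, AEStronglyMeasurable h (volume.restrict (Icc c d)) →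
      ∫⁻ r in Icc c d, ‖h r‖ₑ ≤ K * eLpNorm h 2 (weightMeasure w) := by
  have hpos : ∀ᵐ r ∂volume.restrict (Icc c d), 0 < w r :=
    (ae_restrict_mem measurableSet_Icc).mono fun r hr => hw.pos r (hcd hr)
  refine ⟨(∫⁻ r in Icc c d, (ENNReal.ofReal (w r))⁻¹) ^ (1 / 2 : ℝ),
    ENNReal.rpow_ne_top_of_nonneg (by norm_num) ?_, fun h hh => ?_⟩
  · have hinv := hw.locallyIntegrableOn_inv.integrableOn_compact_subset hcd isCompact_Icc
    refine ((lintegral_congr_ae ?_).trans_lt hinv.lintegral_lt_top).ne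
    filter_upwards [hpos] with r hr
    exact (ENNReal.ofReal_inv_of_pos hr).symm
  · refine (lintegral_enorm_le_rpow_lintegral_inv_mul_eLpNorm
      (hw.aemeasurable.mono_measure (Measure.restrict_mono hcd le_rfl)).ennreal_ofReal
      (hpos.mono fun r hr => (ENNReal.ofReal_pos.2 hr).ne')
      (.of_forall fun _ => ENNReal.ofReal_ne_top) hh).trans ?_
    gcongr
    rw [← Measure.restrict_restrict_of_subset hcd, ← restrict_withDensity measurableSet_Icc]
    exact Measure.restrict_le_self

theorem IsWeight.aestronglyMeasurable (hw : IsWeight w) {h : ℝ → ℂ}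
    (hh : MemLp h 2 (weightMeasure w)) (hcd : Icc c d ⊆ Ioi 0) :
    AEStronglyMeasurable h (volume.restrict (Icc c d)) :=
  (hh.1.mono_ac (Measure.ae_le_iff_absolutelyContinuous.1
    fun _ => hw.ae_weightMeasure_iff.1)).mono_measure (Measure.restrict_mono hcd le_rfl)

theorem IsWeight.intervalIntegrable (hw : IsWeight w) {h : ℝ → ℂ}
    (hh : MemLp h 2 (weightMeasure w)) (hle : c ≤ d) (hcd : Icc c d ⊆ Ioi 0) :
    IntervalIntegrable h volume c d := by
  obtain ⟨K, hK, hbound⟩ := hw.exists_lintegral_enorm_le hcd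
  have hmeas := hw.aestronglyMeasurable hh hcd
  exact (intervalIntegrable_iff_integrableOn_Icc_of_le hle).2
    ⟨hmeas, (hbound h hmeas).trans_lt (ENNReal.mul_lt_top hK.lt_top hh.2)⟩

theorem IsWeight.tendsto_integral_norm_of_tendsto_eLpNorm (hw : IsWeight w) {ι : Type*}
    {l : Filter ι} {F : ι → ℝ → ℂ} (hF : ∀ i, MemLp (F i) 2 (weightMeasure w))
    (hlim : Tendsto (fun i => eLpNorm (F i) 2 (weightMeasure w)) l (𝓝 0)) (hle : c ≤ d)
    (hcd : Icc c d ⊆ Ioi 0) : Tendsto (fun i => ∫ t in c..d, ‖F i t‖) l (𝓝 0) := by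
  obtain ⟨K, hK, hbound⟩ := hw.exists_lintegral_enorm_le hcd
  have hmeas (i) := hw.aestronglyMeasurable (hF i) hcd
  have hlintegral : Tendsto (fun i => ∫⁻ t in Icc c d, ‖F i t‖ₑ) l (𝓝 0) :=
    tendsto_of_tendsto_of_tendsto_of_le_of_le tendsto_const_nhds
      (by simpa using ENNReal.Tendsto.const_mul hlim (.inr hK)) (fun _ => zero_le)
      fun i => hbound _ (hmeas i)
  refine ((ENNReal.tendsto_toReal ENNReal.zero_ne_top).comp hlintegral).congr fun i => ?_
  rw [intervalIntegral.integral_of_le hle, ← integral_Icc_eq_integral_Ioc,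
    integral_norm_eq_lintegral_enorm (hmeas i), Function.comp_apply]

end Weight

/-! ### Spectral components of quasi-analytic vectors -/

section SpectralComponent

variable {ι 𝕜 H : Type*} [RCLike 𝕜] [NormedAddCommGroup H] [InnerProductSpace 𝕜 H]

theorem sum_norm_inner_mul_inner_le {v : ι → H} (hv : Orthonormal 𝕜 v) (x y : H)
    (s : Finset ι) : ∑ k ∈ s, ‖inner 𝕜 x (v k) * inner 𝕜 (v k) y‖ ≤ ‖x‖ * ‖y‖ := by
  have hbessel (z : H) : √(∑ k ∈ s, ‖inner 𝕜 (v k) z‖ ^ 2) ≤ ‖z‖ :=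
    Real.sqrt_le_iff.2 ⟨norm_nonneg z, hv.sum_inner_products_le z⟩
  calc ∑ k ∈ s, ‖inner 𝕜 x (v k) * inner 𝕜 (v k) y‖
      = ∑ k ∈ s, ‖inner 𝕜 (v k) x‖ * ‖inner 𝕜 (v k) y‖ := by
        simp only [norm_mul, norm_inner_symm x]
    _ ≤ √(∑ k ∈ s, ‖inner 𝕜 (v k) x‖ ^ 2) * √(∑ k ∈ s, ‖inner 𝕜 (v k) y‖ ^ 2) :=
        Real.sum_mul_le_sqrt_mul_sqrt s _ _
    _ ≤ ‖x‖ * ‖y‖ := by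
        gcongr
        exacts [hbessel x, hbessel y]

variable {b : HilbertBasis ι 𝕜 H} {eig : ι → ℝ} {F : ℕ → H}

theorem inner_eq_pow_mul_inner_zero
    (hF : ∀ m k, inner 𝕜 (b k) (F (m + 1)) = eig k * inner 𝕜 (b k) (F m)) (m : ℕ) (k : ι) :
    inner 𝕜 (b k) (F m) = ((eig k ^ m : ℝ) : 𝕜) * inner 𝕜 (b k) (F 0) := by
  induction m with
  | zero => simp
  | succ m ih =>
    rw [hF, ih]
    push_cast
    ring

theorem tsum_fiber_inner_mul_inner_eq_zero [Countable ι] (heig : ∀ k, 0 ≤ eig k)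
    (hF : ∀ m k, inner 𝕜 (b k) (F (m + 1)) = eig k * inner 𝕜 (b k) (F m))
    (hcarleman : ∑' m : ℕ, ‖F (m + 1)‖ₑ ^ (-(1 / (2 * ((m : ℝ) + 1)))) = ⊤) {φ : H}
    (hφ : ∀ m, inner 𝕜 φ (F m) = 0) (ev : ℝ) :
    ∑' k : eig ⁻¹' {ev}, inner 𝕜 φ (b k) * inner 𝕜 (b k) (F 0) = 0 := by
  set β : ι → 𝕜 := fun k => inner 𝕜 φ (b k) * inner 𝕜 (b k) (F 0)
  have hmoment (m k) : eig k ^ m • β k = inner 𝕜 φ (b k) * inner 𝕜 (b k) (F m) := by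
    rw [inner_eq_pow_mul_inner_zero hF m k, RCLike.real_smul_eq_coe_mul]
    ring
  have hnorm (m k) : eig k ^ m * ‖β k‖ = ‖inner 𝕜 φ (b k) * inner 𝕜 (b k) (F m)‖ := by
    rw [← hmoment, norm_smul, Real.norm_of_nonneg (pow_nonneg (heig k) m)]
  have hsummable (m) : Summable fun k => eig k ^ m * ‖β k‖ := by
    simp only [hnorm]
    exact summable_of_sum_le (fun _ => norm_nonneg _)
      (sum_norm_inner_mul_inner_le b.orthonormal φ (F m))
  have habsMoment (m) : ENNReal.ofReal (absMoment eig β (m + 1)) ≤ ‖φ‖ₑ * ‖F (m + 1)‖ₑ := by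
    rw [← ofReal_norm, ← ofReal_norm, ← ENNReal.ofReal_mul (norm_nonneg φ)]
    refine ENNReal.ofReal_le_ofReal ((hsummable (m + 1)).tsum_le_of_sum_le fun s => ?_)
    simp only [hnorm]
    exact sum_norm_inner_mul_inner_le b.orthonormal φ (F (m + 1)) s
  refine tsum_fiber_eq_zero_of_moments heig hsummable (fun m => ?_)
    (tsum_rpow_neg_eq_top_of_le_mul (fun m => ⟨by positivity, ?_⟩) enorm_ne_top habsMoment
      hcarleman) ev
  · simp only [hmoment]
    rw [b.tsum_inner_mul_inner, hφ]
  · rw [div_le_one (by positivity)]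
    linarith [(m.cast_nonneg : (0 : ℝ) ≤ m)]

end SpectralComponent

/-! ### Orthogonal expansions -/

section Expansion

variable {μ : Measure ℝ} {ψ : ℕ → ℝ → ℂ} {f g : ℝ → ℂ}

theorem inner_toLp (hf : MemLp f 2 μ) (hg : MemLp g 2 μ) :
    inner ℂ (hf.toLp f) (hg.toLp g) = ∫ r, conj (f r) * g r ∂μ := by
  rw [L2.inner_def]
  refine integral_congr_ae ?_
  filter_upwards [hf.coeFn_toLp, hg.coeFn_toLp] with r hfr hgr
  rw [hfr, hgr, RCLike.inner_apply, mul_comm]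

theorem normConst_eq_inv_norm_toLp_sq (hψ : ∀ k, MemLp (ψ k) 2 μ) (k : ℕ) :
    normConst μ ψ k = (‖(hψ k).toLp (ψ k)‖ ^ 2)⁻¹ := by
  rw [normConst, norm_sq_eq_re_inner (𝕜 := ℂ), inner_toLp]
  simp only [Complex.conj_mul', ← Complex.ofReal_pow, integral_complex_ofReal,
    RCLike.re_eq_complex_re, Complex.ofReal_re]

/-- The coefficient `c_k ⟨f, ψ_k⟩` of `ψ_k` in the orthogonal expansion of `f`. -/
noncomputable def expansionCoeff (μ : Measure ℝ) (ψ : ℕ → ℝ → ℂ) (f : ℝ → ℂ) (k : ℕ) : ℂ :=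
  normConst μ ψ k * ∫ r, conj (ψ k r) * f r ∂μ

/-- The part of the orthogonal expansion of `f` with respect to `ψ` with indices in `s`. -/
noncomputable def partialExpansion (μ : Measure ℝ) (ψ : ℕ → ℝ → ℂ) (f : ℝ → ℂ) (s : Finset ℕ)
    (r : ℝ) : ℂ :=
  ∑ k ∈ s, expansionCoeff μ ψ f k * ψ k r

theorem toLp_sum_mul (hψ : ∀ k, MemLp (ψ k) 2 μ) (c : ℕ → ℂ) {s : Finset ℕ}
    (h : MemLp (fun r => ∑ k ∈ s, c k * ψ k r) 2 μ) :
    h.toLp _ = ∑ k ∈ s, c k • (hψ k).toLp (ψ k) := by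
  refine Lp.ext (h.coeFn_toLp.trans ?_)
  have hterm : ∀ᵐ r ∂μ, ∀ k ∈ s, (c k • (hψ k).toLp (ψ k)) r = c k * ψ k r := by
    refine (Finset.eventually_all s).2 fun k _ => ?_
    filter_upwards [Lp.coeFn_smul (c k) ((hψ k).toLp (ψ k)), (hψ k).coeFn_toLp] with r hsmul hr
    rw [hsmul, Pi.smul_apply, hr, smul_eq_mul]
  filter_upwards [Lp.coeFn_finsetSum s fun k => c k • (hψ k).toLp (ψ k), hterm] with r hsum hr
  rw [hsum, Finset.sum_apply]
  exact Finset.sum_congr rfl fun k hk => (hr k hk).symm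

theorem memLp_partialExpansion (hψ : ∀ k, MemLp (ψ k) 2 μ) (f : ℝ → ℂ) (s : Finset ℕ) :
    MemLp (partialExpansion μ ψ f s) 2 μ :=
  memLp_finsetSum _ fun k _ => (hψ k).const_mul _

theorem IsOrthogonalBasis.toLp_ne_zero (hψ : IsOrthogonalBasis μ ψ) (k : ℕ) :
    (hψ.memLp k).toLp (ψ k) ≠ 0 := fun h =>
  hψ.ne_zero k ((hψ.memLp k).coeFn_toLp.symm.trans (h ▸ Lp.coeFn_zero ℂ 2 μ))

theorem IsOrthogonalBasis.inner_toLp_eq_zero (hψ : IsOrthogonalBasis μ ψ) {j k : ℕ}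
    (hjk : j ≠ k) : inner ℂ ((hψ.memLp j).toLp (ψ j)) ((hψ.memLp k).toLp (ψ k)) = 0 := by
  rw [inner_toLp, hψ.orthogonal j k hjk]

theorem IsOrthogonalBasis.orthonormal (hψ : IsOrthogonalBasis μ ψ) :
    Orthonormal ℂ fun k => (‖(hψ.memLp k).toLp (ψ k)‖⁻¹ : ℂ) • (hψ.memLp k).toLp (ψ k) :=
  ⟨fun k => norm_smul_inv_norm (hψ.toLp_ne_zero k), fun j k hjk => by
    simp only [inner_smul_left, inner_smul_right, hψ.inner_toLp_eq_zero hjk, mul_zero]⟩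

theorem IsOrthogonalBasis.top_le_closure_span_normalized (hψ : IsOrthogonalBasis μ ψ) :
    ⊤ ≤ (Submodule.span ℂ (range fun k =>
      (‖(hψ.memLp k).toLp (ψ k)‖⁻¹ : ℂ) • (hψ.memLp k).toLp (ψ k))).topologicalClosure := by
  rw [← hψ.dense_span]
  refine Submodule.topologicalClosure_mono (Submodule.span_le.2 ?_)
  rintro _ ⟨k, rfl⟩
  have hnorm : (‖(hψ.memLp k).toLp (ψ k)‖⁻¹ : ℂ) ≠ 0 :=
    inv_ne_zero (mod_cast norm_ne_zero_iff.2 (hψ.toLp_ne_zero k))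
  exact (Submodule.smul_mem_iff _ hnorm).1 (Submodule.subset_span ⟨k, rfl⟩)

/-- The Hilbert basis of `L²(μ)` obtained by normalizing an orthogonal basis. -/
noncomputable def IsOrthogonalBasis.hilbertBasis (hψ : IsOrthogonalBasis μ ψ) :
    HilbertBasis ℕ ℂ (Lp ℂ 2 μ) :=
  HilbertBasis.mk hψ.orthonormal hψ.top_le_closure_span_normalized

theorem IsOrthogonalBasis.hilbertBasis_apply (hψ : IsOrthogonalBasis μ ψ) (k : ℕ) :
    hψ.hilbertBasis k = (‖(hψ.memLp k).toLp (ψ k)‖⁻¹ : ℂ) • (hψ.memLp k).toLp (ψ k) := by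
  rw [hilbertBasis, HilbertBasis.coe_mk]

theorem IsOrthogonalBasis.inner_hilbertBasis_toLp (hψ : IsOrthogonalBasis μ ψ)
    (hf : MemLp f 2 μ) (k : ℕ) :
    inner ℂ (hψ.hilbertBasis k) (hf.toLp f) =
      (‖(hψ.memLp k).toLp (ψ k)‖⁻¹ : ℂ) * ∫ r, conj (ψ k r) * f r ∂μ := by
  rw [hψ.hilbertBasis_apply, inner_smul_left, inner_toLp, map_inv₀, Complex.conj_ofReal]

theorem IsOrthogonalBasis.sum_inner_smul_hilbertBasis (hψ : IsOrthogonalBasis μ ψ)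
    (hf : MemLp f 2 μ) (s : Finset ℕ) :
    ∑ k ∈ s, inner ℂ (hψ.hilbertBasis k) (hf.toLp f) • hψ.hilbertBasis k =
      (memLp_partialExpansion hψ.memLp f s).toLp (partialExpansion μ ψ f s) := by
  refine .trans (Finset.sum_congr rfl fun k _ => ?_) (toLp_sum_mul hψ.memLp _ _).symm
  rw [hψ.inner_hilbertBasis_toLp hf, hψ.hilbertBasis_apply, smul_smul, expansionCoeff,
    normConst_eq_inv_norm_toLp_sq hψ.memLp]
  congr 1
  push_cast
  ring

theorem IsOrthogonalBasis.tendsto_eLpNorm_partialExpansion_sub (hψ : IsOrthogonalBasis μ ψ)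
    (hf : MemLp f 2 μ) :
    Tendsto (fun s => eLpNorm (partialExpansion μ ψ f s - f) 2 μ) atTop (𝓝 0) := by
  have hsum : Tendsto (fun s => (memLp_partialExpansion hψ.memLp f s).toLp _) atTop
      (𝓝 (hf.toLp f)) := by
    simp only [← hψ.sum_inner_smul_hilbertBasis hf, ← HilbertBasis.repr_apply_apply]
    exact hψ.hilbertBasis.hasSum_repr (hf.toLp f)
  refine (tendsto_iff_edist_tendsto_0.1 hsum).congr fun s => ?_
  rw [Lp.edist_toLp_toLp]

theorem IsOrthogonalBasis.ae_eq_zero_of_expansionCoeff_eq_zero (hψ : IsOrthogonalBasis μ ψ)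
    (hf : MemLp f 2 μ) (hcoeff : ∀ k, expansionCoeff μ ψ f k = 0) : f =ᵐ[μ] 0 := by
  have hpartial (s) : partialExpansion μ ψ f s = 0 := by
    ext r
    simp [partialExpansion, hcoeff]
  have hlim := hψ.tendsto_eLpNorm_partialExpansion_sub hf
  simp only [hpartial, zero_sub, eLpNorm_neg, tendsto_const_nhds_iff] at hlim
  exact (eLpNorm_eq_zero_iff hf.1 two_ne_zero).1 hlim

theorem IsOrthogonalBasis.eq_zero_of_sum_mul_ae_eq_zero (hψ : IsOrthogonalBasis μ ψ)
    {c : ℕ → ℂ} {s : Finset ℕ} (hsum : (fun r => ∑ k ∈ s, c k * ψ k r) =ᵐ[μ] 0) {k : ℕ}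
    (hk : k ∈ s) : c k = 0 := by
  have hmem : MemLp (fun r => ∑ k ∈ s, c k * ψ k r) 2 μ :=
    memLp_finsetSum _ fun k _ => (hψ.memLp k).const_mul _
  have hindep : LinearIndependent ℂ fun k => (hψ.memLp k).toLp (ψ k) :=
    linearIndependent_of_ne_zero_of_inner_eq_zero hψ.toLp_ne_zero
      fun _ _ hjk => hψ.inner_toLp_eq_zero hjk
  refine linearIndependent_iff'.1 hindep s c ?_ k hk
  rw [← toLp_sum_mul hψ.memLp c hmem]
  exact ((hmem.toLp_eq_toLp_iff MemLp.zero).2 hsum).trans (MemLp.toLp_zero _)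

end Expansion

/-! ### Eigenfunction expansions -/

section EigenfunctionExpansion

variable {μ : Measure ℝ} {w : ℝ → ℝ} {n : ℕ} {a : ℕ → ℝ → ℂ} {ψ : ℕ → ℝ → ℂ} {eig : ℕ → ℝ}
  {f g : ℝ → ℂ} {Ω : Set ℝ}

theorem IsImage.integral_conj_mul_eq (hfg : IsImage μ n a ψ f g)
    (hμ : ∀ᵐ r ∂μ, r ∈ Ioi 0) (hψ_eig : ∀ k, IsEigenfunction n a (eig k) (ψ k)) (k : ℕ) :
    ∫ r, conj (ψ k r) * g r ∂μ = eig k * ∫ r, conj (ψ k r) * f r ∂μ := by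
  rw [hfg.2.2 k, ← integral_const_mul]
  refine integral_congr_ae ?_
  filter_upwards [hμ] with r hr
  rw [(hψ_eig k).diffOp_eq r hr, map_mul, Complex.conj_ofReal, mul_assoc]

theorem IsWeight.ae_mem_Ioi (hw : IsWeight w) : ∀ᵐ r ∂weightMeasure w, r ∈ Ioi 0 :=
  hw.ae_weightMeasure_iff.2 (ae_restrict_mem measurableSet_Ioi)

theorem IsImage.diffOp_partialExpansion (hfg : IsImage μ n a ψ f g)
    (hμ : ∀ᵐ r ∂μ, r ∈ Ioi 0) (hψ_eig : ∀ k, IsEigenfunction n a (eig k) (ψ k))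
    (s : Finset ℕ) {r : ℝ} (hr : 0 < r) :
    diffOp n a (partialExpansion μ ψ f s) r = partialExpansion μ ψ g s r := by
  refine (diffOp_sum_mul _ (fun k _ => (hψ_eig k).contDiffOn) hr).trans
    (Finset.sum_congr rfl fun k _ => ?_)
  rw [(hψ_eig k).diffOp_eq r hr, expansionCoeff, expansionCoeff,
    hfg.integral_conj_mul_eq hμ hψ_eig]
  ring

theorem IsImage.ae_eq_zero_of_isOpen (hfg : IsImage (weightMeasure w) n a ψ f g)
    (hw : IsWeight w) (hP : IsElliptic n a) (hψ : IsOrthogonalBasis (weightMeasure w) ψ)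
    (hψ_eig : ∀ k, IsEigenfunction n a (eig k) (ψ k)) (hΩ : IsOpen Ω) (hΩ_pos : Ω ⊆ Ioi 0)
    (hf : ∀ᵐ r ∂volume.restrict Ω, f r = 0) : ∀ᵐ r ∂volume.restrict Ω, g r = 0 := by
  have hmem (h : ℝ → ℂ) (s) := memLp_partialExpansion hψ.memLp h s
  refine hP.ae_eq_zero_of_tendstoGraph (l := atTop) (W := partialExpansion (weightMeasure w) ψ f)
    hΩ hΩ_pos fun c d hcd hsub => ?_
  have hpos := hsub.trans hΩ_pos
  have hmem_Icc {t : ℝ} (ht : t ∈ uIoc c d) : t ∈ Icc c d :=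
    uIcc_of_le hcd ▸ uIoc_subset_uIcc ht
  refine ⟨fun s => ContDiffOn.sum fun k _ => contDiffOn_const.mul (hψ_eig k).contDiffOn,
    hw.intervalIntegrable hfg.2.1 hcd hpos, ?_, ?_⟩
  · refine (hw.tendsto_integral_norm_of_tendsto_eLpNorm (fun s => (hmem f s).sub hfg.1)
      (hψ.tendsto_eLpNorm_partialExpansion_sub hfg.1) hcd hpos).congr fun s =>
        intervalIntegral.integral_congr_ae ?_
    filter_upwards [(ae_restrict_iff' hΩ.measurableSet).1 hf] with t hft ht
    rw [Pi.sub_apply, hft (hsub (hmem_Icc ht)), sub_zero]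
  · refine (hw.tendsto_integral_norm_of_tendsto_eLpNorm (fun s => (hmem g s).sub hfg.2.1)
      (hψ.tendsto_eLpNorm_partialExpansion_sub hfg.2.1) hcd hpos).congr fun s =>
        intervalIntegral.integral_congr_ae (.of_forall fun t ht => ?_)
    rw [hfg.diffOp_partialExpansion hw.ae_mem_Ioi hψ_eig s (hpos (hmem_Icc ht)), Pi.sub_apply]

theorem linearIndepOn_cauchyData (hψ : IsOrthogonalBasis μ ψ) (hμ : ∀ᵐ r ∂μ, r ∈ Ioi 0)
    (hP : IsElliptic n a) (hψ_eig : ∀ k, IsEigenfunction n a (eig k) (ψ k)) (ev : ℝ) :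
    LinearIndepOn ℂ (fun k => cauchyData n (ψ k) 1) (eig ⁻¹' {ev}) := by
  refine linearIndepOn_iff'.2 fun s c hs hsum k hk => ?_
  have hu : IsEigenfunction n a ev fun r => ∑ k ∈ s, c k * ψ k r :=
    IsEigenfunction.sum_mul c fun k hk => hs hk ▸ hψ_eig k
  have hdata : cauchyData n (fun r => ∑ k ∈ s, c k * ψ k r) 1 = 0 := by
    rw [cauchyData_sum_mul c (fun k _ => (hψ_eig k).contDiffOn) one_pos, hsum]
  exact hψ.eq_zero_of_sum_mul_ae_eq_zero
    (hμ.mono fun r hr => hu.eq_zero_of_cauchyData_eq_zero hP one_pos hdata hr) hk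

theorem finite_preimage_eig (hψ : IsOrthogonalBasis μ ψ) (hμ : ∀ᵐ r ∂μ, r ∈ Ioi 0)
    (hP : IsElliptic n a) (hψ_eig : ∀ k, IsEigenfunction n a (eig k) (ψ k)) (ev : ℝ) :
    (eig ⁻¹' {ev}).Finite :=
  (linearIndepOn_cauchyData hψ hμ hP hψ_eig ev).finite_of_isNoetherian

theorem integral_conj_mul_partialExpansion_eq_zero {F : ℕ → ℝ → ℂ} (hψ : IsOrthogonalBasis μ ψ)
    (heig : ∀ k, 0 ≤ eig k) (hF_mem : ∀ m, MemLp (F m) 2 μ)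
    (hF : ∀ m k, ∫ r, conj (ψ k r) * F (m + 1) r ∂μ = eig k * ∫ r, conj (ψ k r) * F m r ∂μ)
    (hcarleman : ∑' m : ℕ, eLpNorm (F (m + 1)) 2 μ ^ (-(1 / (2 * ((m : ℝ) + 1)))) = ⊤)
    {φ : ℝ → ℂ} (hφ_mem : MemLp φ 2 μ) (hφ : ∀ m, ∫ r, conj (φ r) * F m r ∂μ = 0) {ev : ℝ}
    {s : Finset ℕ} (hs : eig ⁻¹' {ev} = s) :
    ∫ r, conj (φ r) * partialExpansion μ ψ (F 0) s r ∂μ = 0 := by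
  have hfiber := tsum_fiber_inner_mul_inner_eq_zero (b := hψ.hilbertBasis)
    (F := fun m => (hF_mem m).toLp (F m)) (φ := hφ_mem.toLp φ) heig
    (fun m k => by
      rw [hψ.inner_hilbertBasis_toLp, hψ.inner_hilbertBasis_toLp, hF]
      exact mul_left_comm _ _ _)
    (by simpa only [Lp.enorm_toLp] using hcarleman)
    (fun m => by rw [inner_toLp, hφ]) ev
  rw [← inner_toLp hφ_mem (memLp_partialExpansion hψ.memLp (F 0) s),
    ← hψ.sum_inner_smul_hilbertBasis (hF_mem 0), inner_sum]
  rw [hs, Finset.tsum_subtype' s fun k => inner ℂ (hφ_mem.toLp φ) (hψ.hilbertBasis k) *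
    inner ℂ (hψ.hilbertBasis k) ((hF_mem 0).toLp (F 0))] at hfiber
  simpa only [inner_smul_right, mul_comm] using hfiber

theorem ae_eq_zero_of_integral_conj_indicator_mul_eq_zero {u : ℝ → ℂ} (hu : MemLp u 2 μ)
    (hΩ : MeasurableSet Ω) (h : ∫ r, conj (Ω.indicator u r) * u r ∂μ = 0) :
    Ω.indicator u =ᵐ[μ] 0 := by
  have hmem := hu.indicator hΩ
  have hzero : hmem.toLp _ = 0 := by
    rw [← inner_self_eq_zero (𝕜 := ℂ), inner_toLp, ← h]
    refine integral_congr_ae (.of_forall fun r => ?_)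
    by_cases hr : r ∈ Ω <;> simp [hr]
  exact hmem.coeFn_toLp.symm.trans (hzero ▸ Lp.coeFn_zero ℂ 2 μ)

theorem IsEigenfunction.eq_zero_of_indicator_ae_eq_zero {u : ℝ → ℂ} {ev : ℂ}
    (hu : IsEigenfunction n a ev u) (hw : IsWeight w) (hP : IsElliptic n a) (hΩ : IsOpen Ω)
    (hΩ_pos : Ω ⊆ Ioi 0) (hΩ_ne : Ω.Nonempty) (hzero : Ω.indicator u =ᵐ[weightMeasure w] 0)
    {x : ℝ} (hx : 0 < x) : u x = 0 := by
  have hae : u =ᵐ[volume.restrict Ω] fun _ => 0 := by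
    filter_upwards [ae_mono (Measure.restrict_mono hΩ_pos le_rfl)
      (hw.ae_weightMeasure_iff.1 hzero), ae_restrict_mem hΩ.measurableSet] with r hr hrΩ
    simpa [indicator_of_mem hrΩ] using hr
  exact hu.eq_zero_of_eqOn_isOpen hP hΩ hΩ_pos hΩ_ne (Measure.eqOn_open_of_ae_eq hae hΩ
    (hu.contDiffOn.continuousOn.mono hΩ_pos) continuousOn_const) hx

theorem expansionCoeff_eq_zero_of_carleman {F : ℕ → ℝ → ℂ} (hw : IsWeight w)
    (hP : IsElliptic n a) (hψ : IsOrthogonalBasis (weightMeasure w) ψ) (heig : ∀ k, 0 ≤ eig k)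
    (hψ_eig : ∀ k, IsEigenfunction n a (eig k) (ψ k))
    (hF : ∀ m, IsImage (weightMeasure w) n a ψ (F m) (F (m + 1)))
    (hcarleman : ∑' m : ℕ, eLpNorm (F (m + 1)) 2 (weightMeasure w) ^
      (-(1 / (2 * ((m : ℝ) + 1)))) = ⊤)
    (hΩ : IsOpen Ω) (hΩ_pos : Ω ⊆ Ioi 0) (hΩ_ne : Ω.Nonempty)
    (hzero : ∀ m, ∀ᵐ r ∂volume.restrict Ω, F m r = 0) (k : ℕ) :
    expansionCoeff (weightMeasure w) ψ (F 0) k = 0 := by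
  obtain ⟨s, hs⟩ := (finite_preimage_eig hψ hw.ae_mem_Ioi hP hψ_eig (eig k)).exists_finset_coe
  set u := partialExpansion (weightMeasure w) ψ (F 0) s
  have hu_mem : MemLp u 2 (weightMeasure w) := memLp_partialExpansion hψ.memLp _ _
  have hu_eig : IsEigenfunction n a (eig k) u := IsEigenfunction.sum_mul _ fun j hj => by
    have hj : j ∈ eig ⁻¹' {eig k} := hs ▸ hj
    exact hj ▸ hψ_eig j
  have horth (m) : ∫ r, conj (Ω.indicator u r) * F m r ∂weightMeasure w = 0 := by
    refine integral_eq_zero_of_ae (hw.ae_weightMeasure_iff.2 (ae_restrict_of_ae ?_))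
    filter_upwards [(ae_restrict_iff' hΩ.measurableSet).1 (hzero m)] with r hr
    by_cases hrΩ : r ∈ Ω <;> simp [hrΩ, hr]
  have hu_indicator := ae_eq_zero_of_integral_conj_indicator_mul_eq_zero hu_mem hΩ.measurableSet
    (integral_conj_mul_partialExpansion_eq_zero hψ heig (fun m => (hF m).1)
      (fun m => (hF m).integral_conj_mul_eq hw.ae_mem_Ioi hψ_eig) hcarleman
      (hu_mem.indicator hΩ.measurableSet) horth hs.symm)
  have hu_zero : u =ᵐ[weightMeasure w] 0 := hw.ae_mem_Ioi.mono fun r hr =>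
    hu_eig.eq_zero_of_indicator_ae_eq_zero hw hP hΩ hΩ_pos hΩ_ne hu_indicator hr
  have hk : k ∈ s := by
    rw [← Finset.mem_coe, hs]
    rfl
  exact hψ.eq_zero_of_sum_mul_ae_eq_zero hu_zero hk

end EigenfunctionExpansion

end EigenExpansion

open EigenExpansion

theorem mainTheorem4_general {w : ℝ → ℝ} (hw : IsWeight w) {n : ℕ} {a : ℕ → ℝ → ℂ}
    (hP : IsElliptic n a) {ψ : ℕ → ℝ → ℂ} (hψ : IsOrthogonalBasis (weightMeasure w) ψ)
    {eig : ℕ → ℝ} (heig : ∀ k, 0 ≤ eig k) (hψ_eig : ∀ k, IsEigenfunction n a (eig k) (ψ k))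
    {Pf : ℕ → ℝ → ℂ} (hPf : ∀ m, IsImage (weightMeasure w) n a ψ (Pf m) (Pf (m + 1)))
    (hcarleman : ∑' m : ℕ, eLpNorm (Pf (m + 1)) 2 (weightMeasure w) ^
      (-(1 / (2 * ((m : ℝ) + 1)))) = ⊤)
    {Ω : Set ℝ} (hΩ : IsOpen Ω) (hΩ_pos : Ω ⊆ Ioi 0) (hΩ_ne : Ω.Nonempty)
    (hzero : ∀ᵐ r ∂volume.restrict Ω, Pf 0 r = 0) :
    ∀ᵐ r ∂volume.restrict (Ioi 0), Pf 0 r = 0 := by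
  have hzero_iterate (m) : ∀ᵐ r ∂volume.restrict Ω, Pf m r = 0 := by
    induction m with
    | zero => exact hzero
    | succ m ih => exact (hPf m).ae_eq_zero_of_isOpen hw hP hψ hψ_eig hΩ hΩ_pos ih
  have hcoeff := expansionCoeff_eq_zero_of_carleman hw hP hψ heig hψ_eig hPf hcarleman
    hΩ hΩ_pos hΩ_ne hzero_iterate
  exact hw.ae_weightMeasure_iff.1
    (hψ.ae_eq_zero_of_expansionCoeff_eq_zero (hPf 0).1 hcoeff)

theorem mainTheorem4
    -- the weight
    (w : ℝ → ℝ) (hw_meas : AEMeasurable w (volume.restrict (Ioi (0 : ℝ))))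
    (hw_pos : ∀ r > 0, 0 < w r)
    (hw_inv : LocallyIntegrableOn (fun r => (w r)⁻¹) (Ioi (0 : ℝ)) volume)
    -- the elliptic operator
    (n : ℕ) (a : ℕ → ℝ → ℂ) (hP : EigenExpansion.IsElliptic n a)
    -- the orthogonal basis of eigenfunctions, normalized at the origin
    (ψ : ℕ → ℝ → ℂ)
    (hψ_basis : EigenExpansion.IsOrthogonalBasis (EigenExpansion.weightMeasure w) ψ)
    (hψ_smooth : ∀ k, ContDiffOn ℝ n (ψ k) (Ioi 0))
    (hψ_zero : ∀ k, Tendsto (ψ k) (𝓝[>] 0) (𝓝 1))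
    (eig : ℕ → ℝ) (heig_nonneg : ∀ k, 0 ≤ eig k)
    (hψ_eig : ∀ k, ∀ r > 0, EigenExpansion.diffOp n a (ψ k) r = (eig k : ℂ) * ψ k r)
    -- polynomial growth of the eigenvalues and of the normalizing constants
    (heig_growth : ∃ A > 0, ∃ α > 0, ∀ᶠ k : ℕ in atTop, A * (k : ℝ) ^ (α : ℝ) ≤ eig k)
    (hc_growth : ∃ C β : ℝ, ∀ᶠ k : ℕ in atTop,
      EigenExpansion.normConst (EigenExpansion.weightMeasure w) ψ k ≤ C * (k : ℝ) ^ β)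
    -- `Pf m` is `P ^ m f`, which lies in `L²` for every `m`
    (f : ℝ → ℂ) (Pf : ℕ → ℝ → ℂ) (hPf_zero : Pf 0 = f)
    (hPf_succ : ∀ m, EigenExpansion.IsImage (EigenExpansion.weightMeasure w) n a ψ
      (Pf m) (Pf (m + 1)))
    -- the Carleman condition (a term with `P ^ m f = 0` counts as `∞`)
    (hCarleman : ∑' m : ℕ, eLpNorm (Pf (m + 1)) 2 (EigenExpansion.weightMeasure w) ^
      (-(1 / (2 * ((m : ℝ) + 1)))) = ⊤)
    -- `f` vanishes near the origin
    (hf_vanish : ∃ δ > 0, ∀ᵐ r ∂volume.restrict (Ioo (0 : ℝ) δ), f r = 0) :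
    ∀ᵐ r ∂volume.restrict (Ioi (0 : ℝ)), f r = 0 := by
  obtain ⟨δ, hδ, hzero⟩ := hf_vanish
  subst hPf_zero
  exact mainTheorem4_general ⟨hw_meas, hw_pos, hw_inv⟩ hP hψ_basis heig_nonneg
    (fun k => ⟨hψ_smooth k, hψ_eig k⟩) hPf_succ hCarleman isOpen_Ioo Ioo_subset_Ioi_self
    (nonempty_Ioo.2 hδ) hzero
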